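/- Let anti-de Sitter 3-space be $\mathrm{SL}(2,\mathbb R)$ with the bi-invariant Lorentz metric given by $q(X)=-\det X$ on $\mathfrak{sl}(2,\mathbb R)$. Consider smooth null curves $\gamma$ (that is, $\det(\gamma^{-1}\gamma')\equiv 0$) without flex points ($\gamma'$ and its covariant derivative along $\gamma$ are everywhere linearly independent) which admit a spinor frame, i.e. a smooth lift $(\Gamma_+,\Gamma_-)$ to $\mathrm{SL}(2,\mathbb R)\times\mathrm{SL}(2,\mathbb R)$ with $\gamma=\Gamma_+\Gamma_-^{-1}$ and $$\Gamma_\pm^{-1}d\Gamma_\pm=\begin{pmatrix}0&1\\ k\pm1&0\end{pmatrix}\omega ,$$ where the function $k$ is the curvature of $\gamma$ and the nowhere vanishing 1-form $\omega$ is its canonical arc element. An extremal trajectory with multiplier $m\in\mathbb R$ is such a curve, parametrized by the natural parameter ($\omega=ds$), with non-constant curvature, that is a critical point of $\mathcal L_m(\gamma)=\int_\gamma(m+k)\,\omega$ under compactly supported variations through curves of this kind (not necessarily naturally parametrized). Two trajectories $\gamma,\tilde\gamma:\mathbb R\to\mathrm{SL}(2,\mathbb R)$ are equivalent if $\tilde\gamma(s)=A\,\gamma(s+c)\,B^{-1}$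 for all $s$, for some $c\in\mathbb R$ and $A,B\in\mathrm{SL}(2,\mathbb R)$. Theorem. There exists a closed discrete subset $\mathcal M_0\subset\mathbb R$ such that, for every $m\in\mathbb R\setminus\mathcal M_0$, there exist countably infinitely many pairwise inequivalent periodic extremal trajectories $\gamma:\mathbb R\to\mathrm{SL}(2,\mathbb R)$ with multiplier $m$. -/

import Mathlib

open scoped MatrixGroups ContDiff

namespace AdS

/-- Real `2 × 2` matrices. -/
abbrev Mat := Matrix (Fin 2) (Fin 2) ℝ

/-- Parametrized curves in anti-de Sitter 3-space, modelled as `SL(2, ℝ)` with the bi-invariant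
Lorentz metric given on the Lie algebra by `q X = - det X`. -/
abbrev Curve := ℝ → SL(2, ℝ)

noncomputable section

/-- Entrywise derivative of a matrix-valued function. -/
def mderiv (V : ℝ → Mat) (t : ℝ) : Mat :=
  Matrix.of fun i j => deriv (fun s => V s i j) t

/-- Velocity `γ'` of a curve. -/
def velocity (γ : Curve) (t : ℝ) : Mat :=
  mderiv (fun s => (γ s : Mat)) t

/-- `γ⁻¹ γ'`. -/
def leftVelocity (γ : Curve) (t : ℝ) : Mat :=
  ((γ t)⁻¹ : SL(2, ℝ)) * velocity γ t

/-- Levi-Civita covariant derivative of a vector field `V` along `γ`. For the bi-invariant metric,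
with `v = γ⁻¹ V` and `X = γ⁻¹ γ'`, it is `γ (v' + [X, v] / 2)`. -/
def covDeriv (γ : Curve) (V : ℝ → Mat) (t : ℝ) : Mat :=
  (γ t : Mat) *
    (mderiv (fun s => (((γ s)⁻¹ : SL(2, ℝ)) : Mat) * V s) t +
      (1 / 2 : ℝ) • ⁅leftVelocity γ t, (((γ t)⁻¹ : SL(2, ℝ)) : Mat) * V t⁆)

/-- Smoothness of a curve in `SL(2, ℝ)`. -/
def IsSmooth (γ : Curve) : Prop :=
  ∀ i j, ContDiff ℝ ∞ (fun t => (γ t : Mat) i j)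

/-- Joint smoothness of a one-parameter family of curves in `SL(2, ℝ)`. -/
def IsSmoothFamily (γ : ℝ → Curve) : Prop :=
  ∀ i j, ContDiff ℝ ∞ (fun p : ℝ × ℝ => (γ p.1 p.2 : Mat) i j)

/-- Smooth null curves: `det (γ⁻¹ γ')` vanishes identically. -/
def IsNullCurve (γ : Curve) : Prop :=
  IsSmooth γ ∧ ∀ t, (leftVelocity γ t).det = 0

/-- No flex points: `γ'` and its covariant derivative are everywhere linearly independent. -/
def NoFlex (γ : Curve) : Prop :=
  ∀ t, LinearIndependent ℝ ![velocity γ t, covDeriv γ (velocity γ) t]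

/-- `(Γp, Γm)` is a spinor frame field along `γ`, with curvature function `k` and canonical arc
element `w dt`: it lifts `γ` and
`Γp⁻¹ dΓp = (0, 1; k + 1, 0) w dt`, `Γm⁻¹ dΓm = (0, 1; k - 1, 0) w dt`. -/
structure IsSpinorFrame (γ Γp Γm : Curve) (k w : ℝ → ℝ) : Prop where
  smooth_plus : IsSmooth Γp
  smooth_minus : IsSmooth Γm
  smooth_curvature : ContDiff ℝ ∞ k
  smooth_arc : ContDiff ℝ ∞ w
  arc_ne_zero : ∀ t, w t ≠ 0
  lift : ∀ t, γ t = Γp t * (Γm t)⁻¹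
  plus : ∀ t, leftVelocity Γp t = w t • !![0, 1; k t + 1, 0]
  minus : ∀ t, leftVelocity Γm t = w t • !![0, 1; k t - 1, 0]

/-- A variation of `γ` through null curves without flex points, supported in `[a, b]`, together
with the spinor frames, curvatures and arc elements of its members. -/
structure IsVariation (γ : Curve) (a b : ℝ) (F Γp Γm : ℝ → Curve) (k w : ℝ → ℝ → ℝ) :
    Prop where
  smooth : IsSmoothFamily F
  smooth_plus : IsSmoothFamily Γp
  smooth_minus : IsSmoothFamily Γm
  smooth_curvature : ContDiff ℝ ∞ (fun p : ℝ × ℝ => k p.1 p.2)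
  smooth_arc : ContDiff ℝ ∞ (fun p : ℝ × ℝ => w p.1 p.2)
  null : ∀ ε, IsNullCurve (F ε)
  noFlex : ∀ ε, NoFlex (F ε)
  frame : ∀ ε, IsSpinorFrame (F ε) (Γp ε) (Γm ε) (k ε) (w ε)
  start : F 0 = γ
  support : ∀ ε, ∀ t ∉ Set.Icc a b, F ε t = γ t

/-- `γ` is a critical point of the action `∫ (m + k) w dt` under compactly supported variations. -/
def IsCritical (m : ℝ) (γ : Curve) : Prop :=
  ∀ (a b : ℝ) (F Γp Γm : ℝ → Curve) (k w : ℝ → ℝ → ℝ), a < b →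
    IsVariation γ a b F Γp Γm k w →
      HasDerivAt (fun ε => ∫ t in a..b, (m + k ε t) * w ε t) 0 0

/-- Extremal trajectories with multiplier `m`, defined on the whole line: null curves without flex
points, parametrized by the natural parameter (the arc element is `dt`), with non-constant
curvature, that are critical for the action. -/
def IsTrajectory (m : ℝ) (γ : Curve) : Prop :=
  IsNullCurve γ ∧ NoFlex γ ∧
    (∃ (Γp Γm : Curve) (k : ℝ → ℝ),
      IsSpinorFrame γ Γp Γm k (fun _ => 1) ∧ ¬ ∃ c, ∀ s, k s = c) ∧
    IsCritical m γ

/-- Periodic (closed) curves. -/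
def IsPeriodic (γ : Curve) : Prop :=
  ∃ T > 0, Function.Periodic γ T

/-- Equivalence of curves: `γ₂ s = A γ₁(s + c) B⁻¹`. -/
def Equivalent (γ₁ γ₂ : Curve) : Prop :=
  ∃ (c : ℝ) (A B : SL(2, ℝ)), ∀ s, γ₂ s = A * γ₁ (s + c) * B⁻¹

end

end AdS

namespace AdS

/-! The equation k''' = 6kk' - 2mk' suffices for criticality. Each spinor component carries a
traceless momentum M solving the Lax equation M' = [M, A₀]; integrating the derivative of tr(MS),
with S the transition matrix to the varied frame, shows that the first variation vanishes
(`IsSpinorFrame.isCritical`).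

Solutions are k = c - δ cos φ with k'² = 2Q(k), where Q is the monic cubic with roots c ± δ and m -
2c. For p = m ± 2 the Hill equation f'' = (k ± 1)f has p - k as a product of solutions, so its frame
is explicit and turns by a fixed angle per period of k (`exists_hillFrame`). The trajectory closes
up once both angles are rational multiples of π (`exists_trajectory`).

The angle is R(ρ, τ)/2 with R = `rotationIntegral`, ρ = (p - c)/(m - 2c - p), τ = δ/(p - c)
(`rotation_eq`). R is strictly decreasing in ρ for τ < 1 and continuous up to τ = 1. Fix a level on
which the first angle is rational: it is a curve in the two-parameter family (c, δ). Followed to the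
boundary of the admissible region, the second angle takes different values at the two ends
(`exists_path`), hence infinitely many rational multiples of π in between. Different second angles
give inequivalent curves, since the range of k determines c and δ. Only m = -3 is excluded, where ρ
= 1/2 for p = m + 2 whatever c is. -/

/-! ### Hill frames and the uniqueness of spinor frames -/

/-- The entrywise form of `Γ⁻¹ Γ' = w (0, 1; κ, 0)`. -/
structure IsHillFrame (Γ : Curve) (κ w : ℝ → ℝ) : Prop where
  deriv_zero : ∀ i t, HasDerivAt (fun s => (Γ s : Mat) i 0) (w t * κ t * (Γ t : Mat) i 1) t
  deriv_one : ∀ i t, HasDerivAt (fun s => (Γ s : Mat) i 1) (w t * (Γ t : Mat) i 0) t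

lemma leftVelocity_eq_iff (Γ : Curve) (t : ℝ) (X : Mat) :
    leftVelocity Γ t = X ↔ velocity Γ t = (Γ t : Mat) * X := by
  unfold leftVelocity
  constructor
  · rintro rfl
    rw [← Matrix.mul_assoc, ← Matrix.SpecialLinearGroup.coe_mul, mul_inv_cancel,
      Matrix.SpecialLinearGroup.coe_one, Matrix.one_mul]
  · intro h
    rw [h, ← Matrix.mul_assoc, ← Matrix.SpecialLinearGroup.coe_mul, inv_mul_cancel,
      Matrix.SpecialLinearGroup.coe_one, Matrix.one_mul]

lemma isHillFrame_of_leftVelocity {Γ : Curve} {κ w : ℝ → ℝ} (hs : IsSmooth Γ)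
    (h : ∀ t, leftVelocity Γ t = w t • !![0, 1; κ t, 0]) : IsHillFrame Γ κ w := by
  have hd : ∀ i j t, HasDerivAt (fun s => (Γ s : Mat) i j)
      (((Γ t : Mat) * (w t • !![0, 1; κ t, 0])) i j) t := by
    intro i j t
    have h1 := (leftVelocity_eq_iff Γ t _).1 (h t)
    rw [← h1]
    exact (((hs i j).differentiable (by simp)) t).hasDerivAt
  constructor
  · intro i t
    convert hd i 0 t using 1
    simp [Matrix.mul_apply, Fin.sum_univ_two]; ring
  · intro i t
    convert hd i 1 t using 1
    simp [Matrix.mul_apply, Fin.sum_univ_two]; ring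

lemma IsHillFrame.leftVelocity_eq {Γ : Curve} {κ w : ℝ → ℝ} (h : IsHillFrame Γ κ w) (t : ℝ) :
    leftVelocity Γ t = w t • !![0, 1; κ t, 0] := by
  rw [leftVelocity_eq_iff]
  ext i j
  fin_cases j
  · simp [velocity, mderiv, (h.deriv_zero i t).deriv, Matrix.mul_apply, Fin.sum_univ_two]; ring
  · simp [velocity, mderiv, (h.deriv_one i t).deriv, Matrix.mul_apply, Fin.sum_univ_two]; ring

lemma det_entries (A : SL(2, ℝ)) :
    (A : Mat) 0 0 * (A : Mat) 1 1 - (A : Mat) 0 1 * (A : Mat) 1 0 = 1 := by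
  rw [← Matrix.det_fin_two]; exact A.2

lemma coe_inv_mul_entries (A B : SL(2, ℝ)) :
    ((A⁻¹ * B : SL(2, ℝ)) : Mat) =
      !![(A : Mat) 1 1 * (B : Mat) 0 0 - (A : Mat) 0 1 * (B : Mat) 1 0,
          (A : Mat) 1 1 * (B : Mat) 0 1 - (A : Mat) 0 1 * (B : Mat) 1 1;
         (A : Mat) 0 0 * (B : Mat) 1 0 - (A : Mat) 1 0 * (B : Mat) 0 0,
          (A : Mat) 0 0 * (B : Mat) 1 1 - (A : Mat) 1 0 * (B : Mat) 0 1] := by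
  rw [Matrix.SpecialLinearGroup.coe_mul, Matrix.SpecialLinearGroup.coe_inv]
  ext i j
  fin_cases i <;> fin_cases j <;>
    simp [Matrix.adjugate_fin_two, Matrix.mul_apply, Fin.sum_univ_two] <;> ring

lemma coe_mul_inv_entries (A B : SL(2, ℝ)) :
    ((A * B⁻¹ : SL(2, ℝ)) : Mat) =
      !![(A : Mat) 0 0 * (B : Mat) 1 1 - (A : Mat) 0 1 * (B : Mat) 1 0,
          (A : Mat) 0 1 * (B : Mat) 0 0 - (A : Mat) 0 0 * (B : Mat) 0 1;
         (A : Mat) 1 0 * (B : Mat) 1 1 - (A : Mat) 1 1 * (B : Mat) 1 0,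
          (A : Mat) 1 1 * (B : Mat) 0 0 - (A : Mat) 1 0 * (B : Mat) 0 1] := by
  rw [Matrix.SpecialLinearGroup.coe_mul, Matrix.SpecialLinearGroup.coe_inv]
  ext i j
  fin_cases i <;> fin_cases j <;>
    simp [Matrix.adjugate_fin_two, Matrix.mul_apply, Fin.sum_univ_two] <;> ring

/-- The transition matrix `S = Γ₀⁻¹ Γ` between two frames satisfies `S' = S A - A₀ S`. -/
lemma IsHillFrame.transition {Γ₀ Γ : Curve} {κ₀ w₀ κ w : ℝ → ℝ} (h₀ : IsHillFrame Γ₀ κ₀ w₀)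
    (h : IsHillFrame Γ κ w) (t : ℝ) :
    let S : ℝ → Mat := fun s => (((Γ₀ s)⁻¹ * Γ s : SL(2, ℝ)) : Mat)
    HasDerivAt (fun s => S s 0 0) (w t * κ t * S t 0 1 - w₀ t * S t 1 0) t ∧
    HasDerivAt (fun s => S s 0 1) (w t * S t 0 0 - w₀ t * S t 1 1) t ∧
    HasDerivAt (fun s => S s 1 0) (w t * κ t * S t 1 1 - w₀ t * κ₀ t * S t 0 0) t ∧
    HasDerivAt (fun s => S s 1 1) (w t * S t 1 0 - w₀ t * κ₀ t * S t 0 1) t := by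
  have a0 := fun i => h₀.deriv_zero i t
  have a1 := fun i => h₀.deriv_one i t
  have b0 := fun i => h.deriv_zero i t
  have b1 := fun i => h.deriv_one i t
  simp only [coe_inv_mul_entries]
  simp only [Matrix.of_apply, Matrix.cons_val', Matrix.cons_val_zero, Matrix.cons_val_one,
    Matrix.cons_val_fin_one]
  refine ⟨?_, ?_, ?_, ?_⟩
  · exact (((a1 1).mul (b0 0)).sub ((a1 0).mul (b0 1))).congr_deriv (by ring)
  · exact (((a1 1).mul (b1 0)).sub ((a1 0).mul (b1 1))).congr_deriv (by ring)
  · exact (((a0 0).mul (b0 1)).sub ((a0 1).mul (b0 0))).congr_deriv (by ring)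
  · exact (((a0 0).mul (b1 1)).sub ((a0 1).mul (b1 0))).congr_deriv (by ring)

lemma IsSpinorFrame.hill_plus {γ Γp Γm : Curve} {k w : ℝ → ℝ} (h : IsSpinorFrame γ Γp Γm k w) :
    IsHillFrame Γp (fun t => k t + 1) w := isHillFrame_of_leftVelocity h.smooth_plus h.plus

lemma IsSpinorFrame.hill_minus {γ Γp Γm : Curve} {k w : ℝ → ℝ} (h : IsSpinorFrame γ Γp Γm k w) :
    IsHillFrame Γm (fun t => k t - 1) w := isHillFrame_of_leftVelocity h.smooth_minus h.minus

/-- `γ' = 2 w Γ₊ (0, 0; 1, 0) Γ₋⁻¹`. -/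
lemma IsSpinorFrame.velocity_eq {γ Γp Γm : Curve} {k w : ℝ → ℝ}
    (h : IsSpinorFrame γ Γp Γm k w) (t : ℝ) :
    velocity γ t = (Γp t : Mat) * ((2 * w t) • !![0, 0; 1, 0]) * (((Γm t)⁻¹ : SL(2, ℝ)) : Mat) := by
  have hγ : γ = fun s => Γp s * (Γm s)⁻¹ := funext h.lift
  have a0 := fun i => h.hill_plus.deriv_zero i t
  have a1 := fun i => h.hill_plus.deriv_one i t
  have b0 := fun i => h.hill_minus.deriv_zero i t
  have b1 := fun i => h.hill_minus.deriv_one i t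
  have key : ∀ i j : Fin 2, HasDerivAt (fun s => (γ s : Mat) i j)
     (((Γp t : Mat) * ((2 * w t) • !![0, 0; 1, 0]) * (((Γm t)⁻¹ : SL(2, ℝ)) : Mat) : Mat) i j) t := by
    rw [hγ]
    simp only [coe_mul_inv_entries]
    intro i j
    fin_cases i <;> fin_cases j <;>
      simp only [Matrix.SpecialLinearGroup.coe_inv, Matrix.adjugate_fin_two, Matrix.mul_apply,
        Fin.sum_univ_two, Matrix.of_apply, Matrix.cons_val', Matrix.cons_val_zero,
        Matrix.cons_val_one, Matrix.cons_val_fin_one, Fin.zero_eta, Fin.mk_one, Fin.isValue,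
        Matrix.smul_apply, smul_eq_mul]
    · exact (((a0 0).mul (b1 1)).sub ((a1 0).mul (b0 1))).congr_deriv (by ring)
    · exact (((a1 0).mul (b0 0)).sub ((a0 0).mul (b1 0))).congr_deriv (by ring)
    · exact (((a0 1).mul (b1 1)).sub ((a1 1).mul (b0 1))).congr_deriv (by ring)
    · exact (((a1 1).mul (b0 0)).sub ((a0 1).mul (b1 0))).congr_deriv (by ring)
  ext i j
  simp only [velocity, mderiv, Matrix.of_apply]
  exact (key i j).deriv

/-- Two spinor frames of curves that agree on an open set agree there up to a common sign. -/
lemma spinorFrame_unique {γ γ' Γp Γm Γp' Γm' : Curve} {k w k' w' : ℝ → ℝ}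
    (h : IsSpinorFrame γ Γp Γm k w) (h' : IsSpinorFrame γ' Γp' Γm' k' w')
    {U : Set ℝ} (hU : IsOpen U) (hγ : ∀ t ∈ U, γ t = γ' t) {t : ℝ} (ht : t ∈ U) :
    (Γp t)⁻¹ * Γp' t = (Γm t)⁻¹ * Γm' t ∧
    (∃ e : ℝ, e ^ 2 = 1 ∧ (((Γp t)⁻¹ * Γp' t : SL(2, ℝ)) : Mat) = !![e, 0; 0, e]) ∧
    w t = w' t ∧ k t = k' t := by
  have hS : ∀ s ∈ U, (Γp s)⁻¹ * Γp' s = (Γm s)⁻¹ * Γm' s := by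
    intro s hs
    have h1 := hγ s hs
    rw [h.lift, h'.lift] at h1
    have h2 : Γp' s = Γp s * (Γm s)⁻¹ * Γm' s := by rw [h1]; group
    rw [h2]; group
  set S : ℝ → Mat := fun s => (((Γp s)⁻¹ * Γp' s : SL(2, ℝ)) : Mat) with hSdef
  -- With N = (0, 0; 1, 0), equality of the velocities says w N S = w' S N. The lower row of this
  -- identity gives both claims.
  have hvel : ∀ s ∈ U, S s 0 1 = 0 ∧ w s * S s 0 0 = w' s * S s 1 1 := by
    intro s hs
    have hv : velocity γ s = velocity γ' s := by
      ext i j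
      simp only [velocity, mderiv, Matrix.of_apply]
      apply Filter.EventuallyEq.deriv_eq
      filter_upwards [hU.mem_nhds hs] with r hr
      rw [hγ r hr]
    rw [h.velocity_eq, h'.velocity_eq] at hv
    have h3 : ((2 * w s) • !![0, 0; 1, 0] : Mat) * (((Γm s)⁻¹ * Γm' s : SL(2, ℝ)) : Mat)
        = S s * ((2 * w' s) • !![0, 0; 1, 0]) := by
      have e1 := congrArg (fun X : Mat => (((Γp s)⁻¹ : SL(2, ℝ)) : Mat) * X * (Γm' s : Mat)) hv
      have i1 : (((Γp s)⁻¹ : SL(2, ℝ)) : Mat) * (Γp s : Mat) = 1 := by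
        rw [← Matrix.SpecialLinearGroup.coe_mul, inv_mul_cancel, Matrix.SpecialLinearGroup.coe_one]
      have i2 : (((Γm' s)⁻¹ : SL(2, ℝ)) : Mat) * (Γm' s : Mat) = 1 := by
        rw [← Matrix.SpecialLinearGroup.coe_mul, inv_mul_cancel, Matrix.SpecialLinearGroup.coe_one]
      simp only [hSdef, Matrix.SpecialLinearGroup.coe_mul]
      simp only [Matrix.mul_assoc, i2, Matrix.mul_one] at e1
      rw [← Matrix.mul_assoc, i1, Matrix.one_mul] at e1
      rw [e1, Matrix.mul_assoc]
    rw [← hS s hs] at h3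
    change ((2 * w s) • !![0, 0; 1, 0] : Mat) * S s = S s * ((2 * w' s) • !![0, 0; 1, 0]) at h3
    have q1 := congrFun (congrFun h3 1) 1
    have q2 := congrFun (congrFun h3 1) 0
    simp [Matrix.mul_apply, Fin.sum_univ_two] at q1 q2
    refine ⟨?_, by linarith⟩
    rcases q1 with q1 | q1
    · exact absurd q1 (h.arc_ne_zero s)
    · exact q1
  have hdet : ∀ s, S s 0 0 * S s 1 1 - S s 0 1 * S s 1 0 = 1 := fun s => det_entries _
  have tr := fun s => h.hill_plus.transition h'.hill_plus s
  have zero_deriv : ∀ {f : ℝ → ℝ} {c d s : ℝ}, s ∈ U → (∀ r ∈ U, f r = c) →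
      HasDerivAt f d s → d = 0 := by
    intro f c d s hs hf hd
    have : HasDerivAt (fun _ : ℝ => c) d s := by
      refine hd.congr_of_eventuallyEq ?_
      filter_upwards [hU.mem_nhds hs] with r hr
      rw [hf r hr]
    exact this.unique (hasDerivAt_const s c)
  -- Differentiating S₀₁ = 0 gives w' S₀₀ = w S₁₁. Together with w S₀₀ = w' S₁₁ and S₀₀ S₁₁ = 1 this
  -- forces S₀₀⁴ = 1, whatever the signs of w and w'.
  have hsq : ∀ s ∈ U, S s 0 0 ^ 2 = 1 ∧ S s 1 1 = S s 0 0 ∧ w s = w' s := by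
    intro s hs
    obtain ⟨v1, v2⟩ := hvel s hs
    have d1 := zero_deriv hs (fun r hr => (hvel r hr).1) (tr s).2.1
    change w' s * S s 0 0 - w s * S s 1 1 = 0 at d1
    have d2 := hdet s
    rw [v1] at d2
    have hw := h.arc_ne_zero s
    have e1 : w s * (S s 0 0 ^ 2) = w' s := by linear_combination S s 0 0 * v2 + w' s * d2
    have e2 : w' s * (S s 0 0 ^ 2) = w s := by linear_combination S s 0 0 * d1 + w s * d2
    have e3 : (S s 0 0 ^ 2) ^ 2 = 1 := by
      apply mul_left_cancel₀ hw
      linear_combination S s 0 0 ^ 2 * e1 + e2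
    have e4 : S s 0 0 ^ 2 = 1 := by nlinarith [sq_nonneg (S s 0 0)]
    refine ⟨e4, ?_, by rw [e4] at e1; linarith⟩
    linear_combination S s 0 0 * d2 - S s 1 1 * e4
  have hlow : ∀ s ∈ U, S s 1 0 = 0 := by
    intro s hs
    obtain ⟨v1, v2⟩ := hvel s hs
    obtain ⟨e1, e2, e3⟩ := hsq s hs
    have hd := (tr s).1.pow 2
    have := zero_deriv hs (fun r hr => (hsq r hr).1) hd
    change _ * (S s 0 0) ^ _ * (_ * S s 0 1 - w s * S s 1 0) = 0 at this
    rw [v1] at this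
    have ne : S s 0 0 ≠ 0 := fun h0 => by rw [h0] at e1; norm_num at e1
    have hw := h.arc_ne_zero s
    simpa [ne, hw] using this
  refine ⟨hS t ht, ⟨S t 0 0, (hsq t ht).1, ?_⟩, (hsq t ht).2.2, ?_⟩
  · ext i j
    fin_cases i <;> fin_cases j
    · rfl
    · exact (hvel t ht).1
    · exact hlow t ht
    · exact (hsq t ht).2.1
  -- The lower left entry vanishes identically; its derivative compares the curvatures.
  · have := zero_deriv ht hlow (tr t).2.2.1
    obtain ⟨e1, e2, e3⟩ := hsq t ht
    change w' t * (k' t + 1) * S t 1 1 - w t * (k t + 1) * S t 0 0 = 0 at this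
    rw [e2, ← e3] at this
    have ne : S t 0 0 ≠ 0 := fun h0 => by rw [h0] at e1; norm_num at e1
    have hw := h.arc_ne_zero t
    have h5 : (w t * S t 0 0) * (k t - k' t) = 0 := by linear_combination -this
    rcases mul_eq_zero.1 h5 with h6 | h6
    · exact absurd h6 (mul_ne_zero hw ne)
    · linarith

lemma coe_inv_mul_self (A : SL(2, ℝ)) : ((A⁻¹ : SL(2, ℝ)) : Mat) * (A : Mat) = 1 := by
  rw [← Matrix.SpecialLinearGroup.coe_mul, inv_mul_cancel, Matrix.SpecialLinearGroup.coe_one]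

lemma IsSpinorFrame.inv_mul_velocity {γ Γp Γm : Curve} {k w : ℝ → ℝ}
    (h : IsSpinorFrame γ Γp Γm k w) (t : ℝ) :
    (((γ t)⁻¹ : SL(2, ℝ)) : Mat) * velocity γ t =
      (Γm t : Mat) * ((2 * w t) • !![0, 0; 1, 0]) * (((Γm t)⁻¹ : SL(2, ℝ)) : Mat) := by
  rw [h.velocity_eq, h.lift, mul_inv_rev, inv_inv, Matrix.SpecialLinearGroup.coe_mul]
  simp only [Matrix.mul_assoc]
  rw [← Matrix.mul_assoc (((Γp t)⁻¹ : SL(2, ℝ)) : Mat), coe_inv_mul_self, Matrix.one_mul]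

lemma IsSpinorFrame.isNullCurve {γ Γp Γm : Curve} {k w : ℝ → ℝ}
    (h : IsSpinorFrame γ Γp Γm k w) : IsNullCurve γ := by
  refine ⟨?_, fun t => ?_⟩
  · have hγ : γ = fun s => Γp s * (Γm s)⁻¹ := funext h.lift
    have hp := h.smooth_plus
    have hm := h.smooth_minus
    intro i j
    rw [hγ]
    simp only [coe_mul_inv_entries]
    fin_cases i <;> fin_cases j <;>
      simp only [Matrix.of_apply, Matrix.cons_val', Matrix.cons_val_zero,
        Matrix.cons_val_one, Matrix.cons_val_fin_one, Fin.zero_eta, Fin.mk_one, Fin.isValue]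
    · exact ((hp _ _).mul (hm _ _)).sub ((hp _ _).mul (hm _ _))
    · exact ((hp _ _).mul (hm _ _)).sub ((hp _ _).mul (hm _ _))
    · exact ((hp _ _).mul (hm _ _)).sub ((hp _ _).mul (hm _ _))
    · exact ((hp _ _).mul (hm _ _)).sub ((hp _ _).mul (hm _ _))
  · rw [leftVelocity, h.inv_mul_velocity]
    simp [Matrix.det_mul, Matrix.det_fin_two]

lemma IsSpinorFrame.noFlex {γ Γp Γm : Curve} {k : ℝ → ℝ}
    (h : IsSpinorFrame γ Γp Γm k fun _ => 1) : NoFlex γ := by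
  intro t
  have hcov : covDeriv γ (velocity γ) t =
      (Γp t : Mat) * ((2 : ℝ) • !![1, 0; 0, -1]) * (((Γm t)⁻¹ : SL(2, ℝ)) : Mat) := by
    have hm : mderiv (fun s => (((γ s)⁻¹ : SL(2, ℝ)) : Mat) * velocity γ s) t =
        (Γm t : Mat) * ((2 : ℝ) • !![1, 0; 0, -1]) * (((Γm t)⁻¹ : SL(2, ℝ)) : Mat) := by
      have b1 := fun i => h.hill_minus.deriv_one i t
      simp only [h.inv_mul_velocity]
      have key : ∀ i j : Fin 2, HasDerivAt (fun s => ((Γm s : Mat) *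
            ((2 * (1 : ℝ)) • !![0, 0; 1, 0]) * (((Γm s)⁻¹ : SL(2, ℝ)) : Mat) : Mat) i j)
          (((Γm t : Mat) * ((2 : ℝ) • !![1, 0; 0, -1]) *
            (((Γm t)⁻¹ : SL(2, ℝ)) : Mat) : Mat) i j) t := by
        intro i j
        fin_cases i <;> fin_cases j <;>
          simp [Matrix.SpecialLinearGroup.coe_inv, Matrix.adjugate_fin_two, Matrix.mul_apply,
            Fin.sum_univ_two]
        · exact (((b1 0).mul_const 2).mul (b1 1)).congr_deriv (by ring)
        · exact (((b1 0).mul_const 2).mul (b1 0)).neg.congr_deriv (by ring)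
        · exact (((b1 1).mul_const 2).mul (b1 1)).congr_deriv (by ring)
        · exact (((b1 1).mul_const 2).mul (b1 0)).neg.congr_deriv (by ring)
      ext i j
      simp only [mderiv, Matrix.of_apply]
      exact (key i j).deriv
    have hc : covDeriv γ (velocity γ) t =
        (γ t : Mat) * mderiv (fun s => (((γ s)⁻¹ : SL(2, ℝ)) : Mat) * velocity γ s) t := by
      change (γ t : Mat) * (mderiv (fun s => (((γ s)⁻¹ : SL(2, ℝ)) : Mat) * velocity γ s) t +
        (1 / 2 : ℝ) • ⁅leftVelocity γ t, leftVelocity γ t⁆) = _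
      rw [Ring.lie_def, sub_self, smul_zero, add_zero]
    rw [hc, hm, h.lift, Matrix.SpecialLinearGroup.coe_mul]
    simp only [Matrix.mul_assoc]
    rw [← Matrix.mul_assoc (((Γm t)⁻¹ : SL(2, ℝ)) : Mat) (Γm t : Mat), coe_inv_mul_self,
      Matrix.one_mul]
  rw [LinearIndependent.pair_iff, hcov, h.velocity_eq]
  intro a b hab
  have e1 := congrArg
    (fun X : Mat => (((Γp t)⁻¹ : SL(2, ℝ)) : Mat) * X * (Γm t : Mat)) hab
  simp only [Matrix.mul_add, Matrix.add_mul, Matrix.mul_smul, Matrix.smul_mul, Matrix.mul_assoc,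
    coe_inv_mul_self, Matrix.mul_one, Matrix.mul_zero, Matrix.zero_mul] at e1
  simp only [← Matrix.mul_assoc, coe_inv_mul_self, Matrix.one_mul] at e1
  have q1 := congrFun (congrFun e1 1) 0
  have q2 := congrFun (congrFun e1 0) 0
  simp at q1 q2
  exact ⟨q1, q2⟩

/-! ### The first variation of the action -/

lemma exists_abs_le_mul_of_vanish {U : ℝ × ℝ → ℝ} (hU : ContDiff ℝ 1 U)
    (h0 : ∀ t, U (0, t) = 0) (a b : ℝ) :
    ∃ C, ∀ e ∈ Set.Icc (-1 : ℝ) 1, ∀ t ∈ Set.Icc a b, |U (e, t)| ≤ C * |e| := by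
  have hc : IsCompact (Set.Icc (-1 : ℝ) 1 ×ˢ Set.Icc a b) := isCompact_Icc.prod isCompact_Icc
  obtain ⟨K, hK⟩ := (hU.locallyLipschitz.locallyLipschitzOn
    (s := Set.Icc (-1 : ℝ) 1 ×ˢ Set.Icc a b)).exists_lipschitzOnWith_of_compact hc
  refine ⟨K, fun e he t ht => ?_⟩
  have := hK.dist_le_mul (e, t) ⟨he, ht⟩ (0, t) ⟨by norm_num, ht⟩
  rw [h0, Real.dist_eq, sub_zero] at this
  refine this.trans (le_of_eq ?_)
  simp [Prod.dist_eq]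

/-- Both factors are O(ε) uniformly on the compact interval, so the integral is O(ε²). -/
lemma hasDerivAt_integral_mul_of_vanish {U V : ℝ × ℝ → ℝ} (hU : ContDiff ℝ 1 U)
    (hV : ContDiff ℝ 1 V) (hU0 : ∀ t, U (0, t) = 0) (hV0 : ∀ t, V (0, t) = 0) {a b : ℝ}
    (hab : a ≤ b) :
    HasDerivAt (fun e => ∫ t in a..b, U (e, t) * V (e, t)) 0 0 := by
  obtain ⟨C, hC⟩ := exists_abs_le_mul_of_vanish hU hU0 a b
  obtain ⟨D, hD⟩ := exists_abs_le_mul_of_vanish hV hV0 a b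
  have : (fun e => ∫ t in a..b, U (e, t) * V (e, t)) =O[nhds 0] fun e => ‖e - 0‖ ^ 2 := by
    apply Asymptotics.IsBigO.of_bound (C * D * |b - a|)
    filter_upwards [Icc_mem_nhds (show (-1 : ℝ) < 0 by norm_num) (show (0 : ℝ) < 1 by norm_num)]
      with e he
    have : ‖∫ t in a..b, U (e, t) * V (e, t)‖ ≤ (C * |e|) * (D * |e|) * |b - a| := by
      apply intervalIntegral.norm_integral_le_of_norm_le_const
      intro t ht
      rw [Set.uIoc_of_le hab] at ht
      have ht' := Set.Ioc_subset_Icc_self ht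
      rw [Real.norm_eq_abs, abs_mul]
      exact mul_le_mul (hC e he t ht') (hD e he t ht') (abs_nonneg _)
        ((abs_nonneg _).trans (hC e he t ht'))
    refine this.trans (le_of_eq ?_)
    simp only [Real.norm_eq_abs, sub_zero, abs_pow, abs_abs]; ring
  simpa using (this.hasFDerivAt (by norm_num)).hasDerivAt

/-- Derivative of `tr (M S)` for the transition matrix `S` and a momentum
`M = (x, y; z, -x)` with `M' = [M, A₀]`. -/
lemma IsHillFrame.hasDerivAt_momentum {Γ₀ Γ : Curve} {κ₀ κ w x y z : ℝ → ℝ}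
    (h₀ : IsHillFrame Γ₀ κ₀ fun _ => 1) (h : IsHillFrame Γ κ w) {t : ℝ}
    (hx : HasDerivAt x (y t * κ₀ t - z t) t) (hy : HasDerivAt y (2 * x t) t)
    (hz : HasDerivAt z (-2 * x t * κ₀ t) t) :
    let S : ℝ → Mat := fun s => (((Γ₀ s)⁻¹ * Γ s : SL(2, ℝ)) : Mat)
    HasDerivAt (fun s => x s * (S s 0 0 - S s 1 1) + y s * S s 1 0 + z s * S s 0 1)
      (S t 0 0 * (z t * (w t - 1)) + S t 1 1 * (y t * (w t * κ t - κ₀ t))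
        - S t 1 0 * (x t * (w t - 1)) + S t 0 1 * (x t * (w t * κ t - κ₀ t))) t := by
  intro S
  obtain ⟨h1, h2, h3, h4⟩ := h₀.transition h t
  exact (((hx.mul (h1.sub h4)).add (hy.mul h3)).add (hz.mul h2)).congr_deriv (by
    simp only [Pi.sub_apply]
    change _ * (S t 0 0 - S t 1 1) + x t * ((w t * κ t * S t 0 1 - 1 * S t 1 0) -
      (w t * S t 1 0 - 1 * κ₀ t * S t 0 1)) + (_ * S t 1 0 + y t *
      (w t * κ t * S t 1 1 - 1 * κ₀ t * S t 0 0)) + (_ * S t 0 1 + z t *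
      (w t * S t 0 0 - 1 * S t 1 1)) = _
    ring)

/-- Outside the support of a variation the transition matrices are scalar. -/
lemma IsVariation.transition_scalar {γ : Curve} {a b : ℝ} {F Γp Γm : ℝ → Curve} {k w : ℝ → ℝ → ℝ}
    (hV : IsVariation γ a b F Γp Γm k w) (e : ℝ) :
    ∀ t, t ≤ a ∨ b ≤ t → ∀ Γ, (Γ = Γp ∨ Γ = Γm) →
      ((((Γ 0 t)⁻¹ * Γ e t : SL(2, ℝ)) : Mat) 0 1 = 0 ∧
      (((Γ 0 t)⁻¹ * Γ e t : SL(2, ℝ)) : Mat) 1 0 = 0 ∧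
      (((Γ 0 t)⁻¹ * Γ e t : SL(2, ℝ)) : Mat) 0 0 - (((Γ 0 t)⁻¹ * Γ e t : SL(2, ℝ)) : Mat) 1 1
        = 0) := by
  intro t ht Γ hΓ
  have hcont : ∀ i j, Continuous (fun s => (((Γ 0 s)⁻¹ * Γ e s : SL(2, ℝ)) : Mat) i j) := by
    have hs : ∀ e i j, Continuous (fun s => (Γ e s : Mat) i j) := by
      intro e i j
      rcases hΓ with rfl | rfl
      · exact ((hV.frame e).smooth_plus i j).continuous
      · exact ((hV.frame e).smooth_minus i j).continuous
    intro i j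
    simp only [coe_inv_mul_entries]
    fin_cases i <;> fin_cases j
    · exact ((hs _ _ _).mul (hs _ _ _)).sub ((hs _ _ _).mul (hs _ _ _))
    · exact ((hs _ _ _).mul (hs _ _ _)).sub ((hs _ _ _).mul (hs _ _ _))
    · exact ((hs _ _ _).mul (hs _ _ _)).sub ((hs _ _ _).mul (hs _ _ _))
    · exact ((hs _ _ _).mul (hs _ _ _)).sub ((hs _ _ _).mul (hs _ _ _))
  have hopen : IsOpen (Set.Icc a b)ᶜ := isClosed_Icc.isOpen_compl
  have hU : ∀ s ∈ (Set.Icc a b)ᶜ, (((Γ 0 s)⁻¹ * Γ e s : SL(2, ℝ)) : Mat) 0 1 = 0 ∧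
      (((Γ 0 s)⁻¹ * Γ e s : SL(2, ℝ)) : Mat) 1 0 = 0 ∧
      (((Γ 0 s)⁻¹ * Γ e s : SL(2, ℝ)) : Mat) 0 0 - (((Γ 0 s)⁻¹ * Γ e s : SL(2, ℝ)) : Mat) 1 1
        = 0 := by
    intro s hs
    obtain ⟨h1, ⟨r, -, h2⟩, -⟩ := spinorFrame_unique (hV.frame 0) (hV.frame e) hopen
      (fun u hu => by rw [hV.support 0 u hu, hV.support e u hu]) hs
    have : (((Γ 0 s)⁻¹ * Γ e s : SL(2, ℝ)) : Mat) = !![r, 0; 0, r] := by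
      rcases hΓ with rfl | rfl
      · exact h2
      · rw [← h1]; exact h2
    rw [this]; simp
  have hset : IsClosed {s | (((Γ 0 s)⁻¹ * Γ e s : SL(2, ℝ)) : Mat) 0 1 = 0 ∧
      (((Γ 0 s)⁻¹ * Γ e s : SL(2, ℝ)) : Mat) 1 0 = 0 ∧
      (((Γ 0 s)⁻¹ * Γ e s : SL(2, ℝ)) : Mat) 0 0 - (((Γ 0 s)⁻¹ * Γ e s : SL(2, ℝ)) : Mat) 1 1
        = 0} :=
    (isClosed_eq (hcont _ _) continuous_const).inter ((isClosed_eq (hcont _ _)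
      continuous_const).inter (isClosed_eq ((hcont _ _).sub (hcont _ _)) continuous_const))
  have hcl : t ∈ closure ((Set.Icc a b)ᶜ) := by
    rcases ht with ht | ht
    · have : t ∈ closure (Set.Iio a) := by rw [closure_Iio]; exact ht
      exact closure_mono (t := (Set.Icc a b)ᶜ)
        (fun s hs h => absurd h.1 (not_le.2 (Set.mem_Iio.1 hs))) this
    · have : t ∈ closure (Set.Ioi b) := by rw [closure_Ioi]; exact ht
      exact closure_mono (t := (Set.Icc a b)ᶜ)
        (fun s hs h => absurd h.2 (not_le.2 (Set.mem_Ioi.1 hs))) this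
  exact (closure_minimal hU hset) hcl

/-- At ε = 0 the weights are the entries of the identity matrix and the weighted functions vanish.
Freezing the weights at ε = 0 therefore changes the integral only by products of two vanishing
factors, which are of second order. -/
lemma hasDerivAt_integral_of_weighted_eq_zero {a b : ℝ} (hab : a ≤ b)
    {s₀₀ s₀₁ s₁₀ s₁₁ f g u v : ℝ × ℝ → ℝ} (h₀₀ : ContDiff ℝ 1 s₀₀) (h₀₁ : ContDiff ℝ 1 s₀₁)
    (h₁₀ : ContDiff ℝ 1 s₁₀) (h₁₁ : ContDiff ℝ 1 s₁₁) (hf : ContDiff ℝ 1 f) (hg : ContDiff ℝ 1 g)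
    (hu : ContDiff ℝ 1 u) (hv : ContDiff ℝ 1 v) (e₀₀ : ∀ t, s₀₀ (0, t) = 1)
    (e₀₁ : ∀ t, s₀₁ (0, t) = 0) (e₁₀ : ∀ t, s₁₀ (0, t) = 0) (e₁₁ : ∀ t, s₁₁ (0, t) = 1)
    (ef : ∀ t, f (0, t) = 0) (eg : ∀ t, g (0, t) = 0) (eu : ∀ t, u (0, t) = 0)
    (ev : ∀ t, v (0, t) = 0)
    (key : ∀ e, ∫ t in a..b, (s₀₀ (e, t) * f (e, t) + s₁₁ (e, t) * g (e, t)
      - s₁₀ (e, t) * u (e, t) + s₀₁ (e, t) * v (e, t)) = 0) :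
    HasDerivAt (fun e => ∫ t in a..b, (f (e, t) + g (e, t))) 0 0 := by
  have D1 := hasDerivAt_integral_mul_of_vanish (U := fun p => 1 - s₀₀ p) (contDiff_const.sub h₀₀) hf
    (fun t => by simp [e₀₀]) ef hab
  have D2 := hasDerivAt_integral_mul_of_vanish (U := fun p => 1 - s₁₁ p) (contDiff_const.sub h₁₁) hg
    (fun t => by simp [e₁₁]) eg hab
  have D3 := hasDerivAt_integral_mul_of_vanish h₁₀ hu e₁₀ eu hab
  have D4 := hasDerivAt_integral_mul_of_vanish h₀₁ hv e₀₁ ev hab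
  have D := ((D1.add D2).add D3).sub D4
  refine (D.congr_deriv (by ring)).congr_of_eventuallyEq (Filter.Eventually.of_forall fun e => ?_)
  have c₀₀ := h₀₀.continuous
  have c₀₁ := h₀₁.continuous
  have c₁₀ := h₁₀.continuous
  have c₁₁ := h₁₁.continuous
  have cf := hf.continuous
  have cg := hg.continuous
  have cu := hu.continuous
  have cv := hv.continuous
  simp only [Pi.add_apply, Pi.sub_apply]
  rw [← intervalIntegral.integral_add (Continuous.intervalIntegrable (by fun_prop) _ _)
      (Continuous.intervalIntegrable (by fun_prop) _ _),
    ← intervalIntegral.integral_add (Continuous.intervalIntegrable (by fun_prop) _ _)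
      (Continuous.intervalIntegrable (by fun_prop) _ _),
    ← intervalIntegral.integral_sub (Continuous.intervalIntegrable (by fun_prop) _ _)
      (Continuous.intervalIntegrable (by fun_prop) _ _),
    ← add_zero (∫ t in a..b, _ - _), ← key e,
    ← intervalIntegral.integral_add (Continuous.intervalIntegrable (by fun_prop) _ _)
      (Continuous.intervalIntegrable (by fun_prop) _ _)]
  congr 1
  ext t
  ring

/-- The integrand is the derivative of tr(MS). At both ends S is scalar and M is traceless, so the
boundary terms vanish even if the two scalars differ. -/
lemma IsHillFrame.integral_momentum_eq_zero {Γ₀ Γ : Curve} {κ₀ κ w x y z : ℝ → ℝ} {a b : ℝ}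
    (h₀ : IsHillFrame Γ₀ κ₀ fun _ => 1) (h : IsHillFrame Γ κ w)
    (cκ₀ : Continuous κ₀) (cκ : Continuous κ) (cw : Continuous w)
    (hend : ∀ t, t ≤ a ∨ b ≤ t → ((((Γ₀ t)⁻¹ * Γ t : SL(2, ℝ)) : Mat) 0 1 = 0 ∧
      (((Γ₀ t)⁻¹ * Γ t : SL(2, ℝ)) : Mat) 1 0 = 0 ∧
      (((Γ₀ t)⁻¹ * Γ t : SL(2, ℝ)) : Mat) 0 0 - (((Γ₀ t)⁻¹ * Γ t : SL(2, ℝ)) : Mat) 1 1 = 0))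
    (hx : ∀ t, HasDerivAt x (y t * κ₀ t - z t) t) (hy : ∀ t, HasDerivAt y (2 * x t) t)
    (hz : ∀ t, HasDerivAt z (-2 * x t * κ₀ t) t) :
    ∫ t in a..b, ((((Γ₀ t)⁻¹ * Γ t : SL(2, ℝ)) : Mat) 0 0 * (z t * (w t - 1)) +
      (((Γ₀ t)⁻¹ * Γ t : SL(2, ℝ)) : Mat) 1 1 * (y t * (w t * κ t - κ₀ t)) -
      (((Γ₀ t)⁻¹ * Γ t : SL(2, ℝ)) : Mat) 1 0 * (x t * (w t - 1)) +
      (((Γ₀ t)⁻¹ * Γ t : SL(2, ℝ)) : Mat) 0 1 * (x t * (w t * κ t - κ₀ t))) = 0 := by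
  have hd := fun t => h₀.hasDerivAt_momentum h (hx t) (hy t) (hz t)
  have tr := fun t => h₀.transition h t
  have c00 : Continuous fun t => (((Γ₀ t)⁻¹ * Γ t : SL(2, ℝ)) : Mat) 0 0 :=
    continuous_iff_continuousAt.2 fun t => (tr t).1.continuousAt
  have c01 : Continuous fun t => (((Γ₀ t)⁻¹ * Γ t : SL(2, ℝ)) : Mat) 0 1 :=
    continuous_iff_continuousAt.2 fun t => (tr t).2.1.continuousAt
  have c10 : Continuous fun t => (((Γ₀ t)⁻¹ * Γ t : SL(2, ℝ)) : Mat) 1 0 :=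
    continuous_iff_continuousAt.2 fun t => (tr t).2.2.1.continuousAt
  have c11 : Continuous fun t => (((Γ₀ t)⁻¹ * Γ t : SL(2, ℝ)) : Mat) 1 1 :=
    continuous_iff_continuousAt.2 fun t => (tr t).2.2.2.continuousAt
  have cx : Continuous x := continuous_iff_continuousAt.2 fun t => (hx t).continuousAt
  have cy : Continuous y := continuous_iff_continuousAt.2 fun t => (hy t).continuousAt
  have cz : Continuous z := continuous_iff_continuousAt.2 fun t => (hz t).continuousAt
  have c1 : Continuous fun _ : ℝ => (1 : ℝ) := continuous_const
  obtain ⟨a1, a2, a3⟩ := hend a (Or.inl le_rfl)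
  obtain ⟨b1, b2, b3⟩ := hend b (Or.inr le_rfl)
  have := intervalIntegral.integral_eq_sub_of_hasDerivAt (a := a) (b := b) (fun t _ => hd t)
    (((((c00.mul (cz.mul (cw.sub c1))).add
      (c11.mul (cy.mul ((cw.mul cκ).sub cκ₀)))).sub
      (c10.mul (cx.mul (cw.sub c1)))).add
      (c01.mul (cx.mul ((cw.mul cκ).sub cκ₀)))).intervalIntegrable (μ := MeasureTheory.volume) a b)
  beta_reduce at this
  rw [a1, a2, a3, b1, b2, b3] at this
  rw [this]
  ring

/-- The part of the first variation carried by one spinor component vanishes. -/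
lemma hasDerivAt_component {a b : ℝ} (hab : a < b) {Γ : ℝ → Curve} {κ w : ℝ → ℝ → ℝ}
    (hΓ : IsSmoothFamily Γ) (hκ : ContDiff ℝ ∞ (fun p : ℝ × ℝ => κ p.1 p.2))
    (hw : ContDiff ℝ ∞ (fun p : ℝ × ℝ => w p.1 p.2)) (hw0 : ∀ t, w 0 t = 1)
    (hf : ∀ e, IsHillFrame (Γ e) (κ e) (w e))
    (hend : ∀ e, ∀ t, t ≤ a ∨ b ≤ t → ((((Γ 0 t)⁻¹ * Γ e t : SL(2, ℝ)) : Mat) 0 1 = 0 ∧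
      (((Γ 0 t)⁻¹ * Γ e t : SL(2, ℝ)) : Mat) 1 0 = 0 ∧
      (((Γ 0 t)⁻¹ * Γ e t : SL(2, ℝ)) : Mat) 0 0 - (((Γ 0 t)⁻¹ * Γ e t : SL(2, ℝ)) : Mat) 1 1
        = 0)) {x y z : ℝ → ℝ} (sx : ContDiff ℝ ∞ x) (sy : ContDiff ℝ ∞ y) (sz : ContDiff ℝ ∞ z)
    (hx : ∀ t, HasDerivAt x (y t * κ 0 t - z t) t) (hy : ∀ t, HasDerivAt y (2 * x t) t)
    (hz : ∀ t, HasDerivAt z (-2 * x t * κ 0 t) t) :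
    HasDerivAt (fun e => ∫ t in a..b, (z t * (w e t - 1) + y t * (w e t * κ e t - κ 0 t))) 0 0 := by
  have one_le : (1 : WithTop ℕ∞) ≤ (∞ : WithTop ℕ∞) := by exact_mod_cast le_top
  have sS : ∀ i j, ContDiff ℝ 1
      (fun p : ℝ × ℝ => (((Γ 0 p.2)⁻¹ * Γ p.1 p.2 : SL(2, ℝ)) : Mat) i j) := by
    have h0 : ∀ i j, ContDiff ℝ ∞ (fun p : ℝ × ℝ => (Γ 0 p.2 : Mat) i j) := fun i j =>
      (hΓ i j).comp (contDiff_const.prodMk contDiff_snd)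
    intro i j
    refine ContDiff.of_le ?_ one_le
    simp only [coe_inv_mul_entries]
    fin_cases i <;> fin_cases j
    · exact ((h0 _ _).mul (hΓ _ _)).sub ((h0 _ _).mul (hΓ _ _))
    · exact ((h0 _ _).mul (hΓ _ _)).sub ((h0 _ _).mul (hΓ _ _))
    · exact ((h0 _ _).mul (hΓ _ _)).sub ((h0 _ _).mul (hΓ _ _))
    · exact ((h0 _ _).mul (hΓ _ _)).sub ((h0 _ _).mul (hΓ _ _))
  have S0 : ∀ t, (((Γ 0 t)⁻¹ * Γ 0 t : SL(2, ℝ)) : Mat) = 1 := fun t => by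
    rw [inv_mul_cancel, Matrix.SpecialLinearGroup.coe_one]
  have sx2 : ContDiff ℝ 1 (fun p : ℝ × ℝ => x p.2) := (sx.comp contDiff_snd).of_le one_le
  have sy2 : ContDiff ℝ 1 (fun p : ℝ × ℝ => y p.2) := (sy.comp contDiff_snd).of_le one_le
  have sz2 : ContDiff ℝ 1 (fun p : ℝ × ℝ => z p.2) := (sz.comp contDiff_snd).of_le one_le
  have sα : ContDiff ℝ 1 (fun p : ℝ × ℝ => w p.1 p.2 - 1) := (hw.sub contDiff_const).of_le one_le
  have sβ : ContDiff ℝ 1 (fun p : ℝ × ℝ => w p.1 p.2 * κ p.1 p.2 - κ 0 p.2) :=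
    ((hw.mul hκ).sub (hκ.comp (contDiff_const.prodMk contDiff_snd))).of_le one_le
  have hf0 : IsHillFrame (Γ 0) (κ 0) fun _ => 1 := by
    have := hf 0
    rwa [show w 0 = fun _ => 1 from funext hw0] at this
  have cκ : ∀ e, Continuous (κ e) := fun e =>
    hκ.continuous.comp (by fun_prop : Continuous fun t : ℝ => (e, t))
  have cw : ∀ e, Continuous (w e) := fun e =>
    hw.continuous.comp (by fun_prop : Continuous fun t : ℝ => (e, t))
  exact hasDerivAt_integral_of_weighted_eq_zero hab.le (sS 0 0) (sS 0 1) (sS 1 0) (sS 1 1)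
    (sz2.mul sα) (sy2.mul sβ) (sx2.mul sα) (sx2.mul sβ)
    (fun t => by simp only [S0]; simp) (fun t => by simp only [S0]; simp)
    (fun t => by simp only [S0]; simp) (fun t => by simp only [S0]; simp)
    (fun t => by simp [hw0]) (fun t => by simp [hw0]) (fun t => by simp [hw0])
    (fun t => by simp [hw0])
    (fun e => hf0.integral_momentum_eq_zero (hf e) (cκ 0) (cκ e) (cw e) (hend e) hx hy hz)

/-- If the curvature solves `k''' = 6 k k' - 2 m k'`, the curve is critical. -/
lemma IsSpinorFrame.isCritical {m : ℝ} {γ Γp Γm : Curve} {k : ℝ → ℝ}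
    (h : IsSpinorFrame γ Γp Γm k fun _ => 1) {k₁ k₂ : ℝ → ℝ}
    (sk₁ : ContDiff ℝ ∞ k₁) (sk₂ : ContDiff ℝ ∞ k₂)
    (hk : ∀ t, HasDerivAt k (k₁ t) t) (hk₁ : ∀ t, HasDerivAt k₁ (k₂ t) t)
    (hk₂ : ∀ t, HasDerivAt k₂ (6 * k t * k₁ t - 2 * m * k₁ t) t) : IsCritical m γ := by
  intro a b F Γp' Γm' k' w' hab hV
  -- The frame of the variation at ε = 0 need not be the given one, but its arc element and
  -- curvature are.
  have hu := fun t => spinorFrame_unique h (hV.frame 0) isOpen_univ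
    (fun s _ => by rw [hV.start]) (Set.mem_univ t)
  have hw0 : ∀ t, w' 0 t = 1 := fun t => (hu t).2.2.1.symm
  have hk0 : ∀ t, k' 0 t = k t := fun t => (hu t).2.2.2.symm
  have sk := h.smooth_curvature
  have sk' := hV.smooth_curvature
  have sw' := hV.smooth_arc
  -- The momenta have y = (m + 2 - k)/4 for Γ₊ and y = (k - m + 2)/4 for Γ₋. Then x = y'/2 and z =
  -- κy - x' are forced, and the equation for k''' is the remaining Lax equation. The two integrands
  -- add up to (m + k_ε)w_ε - (m + k).
  have Dp := hasDerivAt_component hab (κ := fun e t => k' e t + 1) hV.smooth_plus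
    (sk'.add contDiff_const) sw' hw0 (fun e => (hV.frame e).hill_plus)
    (fun e t ht => hV.transition_scalar e t ht _ (Or.inl rfl))
    (x := fun t => - k₁ t / 8) (y := fun t => 1 / 2 - (k t - m) / 4)
    (z := fun t => (1 / 2 - (k t - m) / 4) * (k t + 1) + k₂ t / 8)
    (by fun_prop) (by fun_prop) (by fun_prop)
    (fun t => ((hk₁ t).neg.div_const 8).congr_deriv (by rw [hk0]; ring))
    (fun t => (((hk t).sub_const m).div_const 4).const_sub _ |>.congr_deriv (by ring))
    (fun t => ((((((hk t).sub_const m).div_const 4).const_sub (1 / 2)).mul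
      ((hk t).add_const 1)).add ((hk₂ t).div_const 8)).congr_deriv (by rw [hk0]; ring))
  have Dm := hasDerivAt_component hab (κ := fun e t => k' e t - 1) hV.smooth_minus
    (sk'.sub contDiff_const) sw' hw0 (fun e => (hV.frame e).hill_minus)
    (fun e t ht => hV.transition_scalar e t ht _ (Or.inr rfl))
    (x := fun t => k₁ t / 8) (y := fun t => 1 / 2 + (k t - m) / 4)
    (z := fun t => (1 / 2 + (k t - m) / 4) * (k t - 1) - k₂ t / 8)
    (by fun_prop) (by fun_prop) (by fun_prop)
    (fun t => ((hk₁ t).div_const 8).congr_deriv (by rw [hk0]; ring))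
    (fun t => (((hk t).sub_const m).div_const 4).const_add _ |>.congr_deriv (by ring))
    (fun t => ((((((hk t).sub_const m).div_const 4).const_add (1 / 2)).mul
      ((hk t).sub_const 1)).sub ((hk₂ t).div_const 8)).congr_deriv (by rw [hk0]; ring))
  have D := (Dp.add Dm).const_add (∫ t in a..b, (m + k t))
  refine (D.congr_deriv (by ring)).congr_of_eventuallyEq (Filter.Eventually.of_forall fun e => ?_)
  have ce : Continuous fun t : ℝ => (e, t) := by fun_prop
  have cw : Continuous (w' e) := sw'.continuous.comp ce
  have ck : Continuous (k' e) := sk'.continuous.comp ce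
  have ck0 := sk.continuous
  have ck2 := sk₂.continuous
  simp only [Pi.add_apply, hk0]
  rw [← intervalIntegral.integral_add (Continuous.intervalIntegrable (by fun_prop) _ _)
      (Continuous.intervalIntegrable (by fun_prop) _ _),
    ← intervalIntegral.integral_add (Continuous.intervalIntegrable (by fun_prop) _ _)
      (Continuous.intervalIntegrable (by fun_prop) _ _)]
  congr 1
  ext t
  ring

/-! ### Phase equations and explicit Hill frames -/

/-- A solution of an autonomous scalar equation with smooth right-hand side is smooth. -/
lemma contDiff_of_autonomous {g φ : ℝ → ℝ} (hg : ContDiff ℝ ∞ g)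
    (hφ : ∀ t, HasDerivAt φ (g (φ t)) t) : ContDiff ℝ ∞ φ := by
  rw [contDiff_infty]
  intro n
  induction n with
  | zero => exact contDiff_zero.2 (continuous_iff_continuousAt.2 fun t => (hφ t).continuousAt)
  | succ n ih =>
    have hd : deriv φ = g ∘ φ := funext fun t => (hφ t).deriv
    push_cast
    rw [contDiff_succ_iff_deriv]
    refine ⟨fun t => (hφ t).differentiableAt, fun h => absurd h (by simp), ?_⟩
    rw [hd]
    exact (hg.of_le (by exact_mod_cast le_top)).comp ih

/-- An autonomous scalar equation with positive periodic right-hand side has a global solution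
that advances by one period of the right-hand side in constant time. -/
lemma exists_phase {g : ℝ → ℝ} {P : ℝ} (hP : 0 < P) (hg : ContDiff ℝ ∞ g) (hpos : ∀ u, 0 < g u)
    (hper : Function.Periodic g P) :
    ∃ (φ : ℝ → ℝ) (T : ℝ), 0 < T ∧ (∀ t, HasDerivAt φ (g (φ t)) t) ∧ ContDiff ℝ ∞ φ ∧
      (∀ t, φ (t + T) = φ t + P) ∧ Function.Surjective φ := by
  set h : ℝ → ℝ := fun u => (g u)⁻¹ with hh
  have hc : Continuous h := hg.continuous.inv₀ fun u => (hpos u).ne'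
  have hpos' : ∀ u, 0 < h u := fun u => inv_pos.2 (hpos u)
  have hper' : Function.Periodic h P := fun u => by simp only [hh, hper u]
  have hInt : ∀ a b, IntervalIntegrable h MeasureTheory.volume a b := fun a b =>
    hc.intervalIntegrable a b
  -- Separation of variables: φ is the inverse of the time τ needed to reach a given phase. As 1/g
  -- is periodic, each advance by P takes the time τ(P).
  set τ : ℝ → ℝ := fun x => ∫ u in (0 : ℝ)..x, h u with hτ
  have dτ : ∀ x, HasDerivAt τ (h x) x := fun x =>
    intervalIntegral.integral_hasDerivAt_right (hInt _ _)
      hc.aestronglyMeasurable.stronglyMeasurableAtFilter hc.continuousAt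
  have hmono : StrictMono τ := strictMono_of_deriv_pos fun x => by rw [(dτ x).deriv]; exact hpos' x
  have hsurj : Function.Surjective τ :=
    (continuous_iff_continuousAt.2 fun x => (dτ x).continuousAt).surjective
      (hper'.tendsto_atTop_intervalIntegral_of_pos' (hInt _ _) hpos' hP)
      (hper'.tendsto_atBot_intervalIntegral_of_pos' (hInt _ _) hpos' hP)
  let e := hmono.orderIsoOfSurjective τ hsurj
  have he : ∀ t, τ (e.symm t) = t := fun t => e.apply_symm_apply t
  have hd : ∀ t, HasDerivAt e.symm (g (e.symm t)) t := fun t => by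
    have := HasDerivAt.of_local_left_inverse (g := e.symm) (a := t) e.symm.continuous.continuousAt
      (dτ (e.symm t)) (hpos' _).ne' (Filter.Eventually.of_forall he)
    simpa [hh] using this
  refine ⟨e.symm, τ P, intervalIntegral.intervalIntegral_pos_of_pos (hInt _ _) hpos' hP, hd,
    contDiff_of_autonomous hg hd, fun t => ?_, e.symm.surjective⟩
  apply hmono.injective
  have h1 := hper'.intervalIntegral_add_eq_add 0 (e.symm t) hInt
  rw [zero_add] at h1
  rw [he, hτ]
  simp only []
  rw [h1]
  exact congrArg (· + τ P) (he t).symm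

/-- The frame with rows `(f', f)` for `f = √(y / d) sin θ` and `f = √(y / d) cos θ`, where
`y = p - k`, and `k₁` is the derivative of `k`. -/
noncomputable def hillFrame (p d : ℝ) (k k₁ θ : ℝ → ℝ) (hd : 0 < d) (hy : ∀ t, 0 < p - k t) :
    Curve := fun t =>
  ⟨!![-k₁ t / (2 * d * √((p - k t) / d)) * Real.sin (θ t) + Real.cos (θ t) / √((p - k t) / d),
      √((p - k t) / d) * Real.sin (θ t);
      -k₁ t / (2 * d * √((p - k t) / d)) * Real.cos (θ t) - Real.sin (θ t) / √((p - k t) / d),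
      √((p - k t) / d) * Real.cos (θ t)], by
    have hA : √((p - k t) / d) ≠ 0 := (Real.sqrt_pos.2 (div_pos (hy t) hd)).ne'
    rw [Matrix.det_fin_two_of]
    generalize √((p - k t) / d) = A at hA
    field_simp
    linear_combination 2 * d * Real.sin_sq_add_cos_sq (θ t)⟩

lemma isSmooth_hillFrame {p d : ℝ} {k k₁ θ : ℝ → ℝ} (hd : 0 < d) (hy : ∀ t, 0 < p - k t)
    (sk : ContDiff ℝ ∞ k) (sk₁ : ContDiff ℝ ∞ k₁) (sθ : ContDiff ℝ ∞ θ) :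
    IsSmooth (hillFrame p d k k₁ θ hd hy) := by
  have hA0 : ∀ t, (p - k t) / d ≠ 0 := fun t => (div_pos (hy t) hd).ne'
  have hA : ∀ t, √((p - k t) / d) ≠ 0 := fun t => (Real.sqrt_pos.2 (div_pos (hy t) hd)).ne'
  have sA : ContDiff ℝ ∞ fun t => √((p - k t) / d) :=
    ((contDiff_const.sub sk).div_const d).sqrt hA0
  have sA1 : ContDiff ℝ ∞ fun t => -k₁ t / (2 * d * √((p - k t) / d)) :=
    sk₁.neg.div (contDiff_const.mul sA) fun t => mul_ne_zero (by positivity) (hA t)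
  have sc : ContDiff ℝ ∞ fun t => Real.cos (θ t) := sθ.cos
  have ss : ContDiff ℝ ∞ fun t => Real.sin (θ t) := sθ.sin
  intro i j
  fin_cases i <;> fin_cases j
  · exact (sA1.mul ss).add (sc.div sA hA)
  · exact sA.mul ss
  · exact (sA1.mul sc).sub (ss.div sA hA)
  · exact sA.mul sc

/-- With y = p - k, `hκ` is the first integral y'²/4 - yy''/2 + κy² = -d² of the equation satisfied
by products of solutions of f'' = κf. The amplitude A = √(y/d) then solves A'' = κA + A⁻³, and θ' =
A⁻² makes A sin θ and A cos θ solutions. -/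
lemma isHillFrame_hillFrame {p d : ℝ} {k k₁ k₂ κ θ : ℝ → ℝ} (hd : 0 < d) (hy : ∀ t, 0 < p - k t)
    (hk : ∀ t, HasDerivAt k (k₁ t) t) (hk₁ : ∀ t, HasDerivAt k₁ (k₂ t) t)
    (hθ : ∀ t, HasDerivAt θ (d / (p - k t)) t)
    (hκ : ∀ t, k₁ t ^ 2 / 4 + (p - k t) ^ 2 * κ t + (p - k t) * k₂ t / 2 = -d ^ 2) :
    IsHillFrame (hillFrame p d k k₁ θ hd hy) κ fun _ => 1 := by
  have hA0 : ∀ t, 0 < (p - k t) / d := fun t => div_pos (hy t) hd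
  set A : ℝ → ℝ := fun t => √((p - k t) / d) with hAdef
  have hA : ∀ t, A t ≠ 0 := fun t => (Real.sqrt_pos.2 (hA0 t)).ne'
  have hA2 : ∀ t, p - k t = d * A t ^ 2 := fun t => by
    rw [hAdef]; simp only []; rw [Real.sq_sqrt (hA0 t).le]; field_simp
  have dA : ∀ t, HasDerivAt A (-k₁ t / (2 * d * A t)) t := fun t => by
    refine ((((hk t).const_sub p).div_const d).sqrt (hA0 t).ne').congr_deriv ?_
    change -k₁ t / d / (2 * A t) = _
    have := hA t
    field_simp
  have dθ : ∀ t, HasDerivAt θ (1 / A t ^ 2) t := fun t => by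
    refine (hθ t).congr_deriv ?_
    rw [hA2]
    have := hA t
    field_simp
  have dA1 : ∀ t, HasDerivAt (fun t => -k₁ t / (2 * d * A t)) (κ t * A t + 1 / A t ^ 3) t :=
    fun t => by
    have h1 := hA t
    refine (((hk₁ t).neg).div ((dA t).const_mul (2 * d))
      (mul_ne_zero (by positivity) h1)).congr_deriv ?_
    have h2 := hκ t
    rw [hA2 t] at h2
    simp only [Pi.neg_apply]
    field_simp
    have h3 := hd.ne'
    linear_combination (-4) * h2
  have dc := fun t => (dθ t).cos
  have ds := fun t => (dθ t).sin
  constructor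
  · intro i t
    have h1 := hA t
    fin_cases i
    · refine (((dA1 t).mul (ds t)).add ((dc t).div (dA t) h1)).congr_deriv ?_
      change _ = 1 * κ t * (A t * Real.sin (θ t))
      field_simp
      ring
    · refine (((dA1 t).mul (dc t)).sub ((ds t).div (dA t) h1)).congr_deriv ?_
      change _ = 1 * κ t * (A t * Real.cos (θ t))
      field_simp
      ring
  · intro i t
    have h1 := hA t
    fin_cases i
    · refine ((dA t).mul (ds t)).congr_deriv ?_
      change _ = 1 * (-k₁ t / (2 * d * A t) * Real.sin (θ t) + Real.cos (θ t) / A t)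
      field_simp
    · refine ((dA t).mul (dc t)).congr_deriv ?_
      change _ = 1 * (-k₁ t / (2 * d * A t) * Real.cos (θ t) - Real.sin (θ t) / A t)
      field_simp
      ring

/-! ### Invariance of the curvature under equivalence -/

lemma coe_mul_apply (A B : SL(2, ℝ)) (i j : Fin 2) : ((A * B : SL(2, ℝ)) : Mat) i j =
    (A : Mat) i 0 * (B : Mat) 0 j + (A : Mat) i 1 * (B : Mat) 1 j := by
  rw [Matrix.SpecialLinearGroup.coe_mul, Matrix.mul_apply, Fin.sum_univ_two]

lemma IsHillFrame.translate {Γ : Curve} {κ w : ℝ → ℝ} (h : IsHillFrame Γ κ w) (A : SL(2, ℝ))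
    (c : ℝ) :
    IsHillFrame (fun s => A * Γ (s + c)) (fun s => κ (s + c)) (fun s => w (s + c)) := by
  constructor
  · intro i t
    simp only [coe_mul_apply]
    exact ((((h.deriv_zero 0 (t + c)).comp_add_const t c).const_mul _).add
      (((h.deriv_zero 1 (t + c)).comp_add_const t c).const_mul _)).congr_deriv (by ring)
  · intro i t
    simp only [coe_mul_apply]
    exact ((((h.deriv_one 0 (t + c)).comp_add_const t c).const_mul _).add
      (((h.deriv_one 1 (t + c)).comp_add_const t c).const_mul _)).congr_deriv (by ring)

lemma IsSmooth.translate {Γ : Curve} (h : IsSmooth Γ) (A : SL(2, ℝ)) (c : ℝ) :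
    IsSmooth fun s => A * Γ (s + c) := by
  intro i j
  simp only [coe_mul_apply]
  have hs : ∀ i j, ContDiff ℝ ∞ (fun s => (Γ (s + c) : Mat) i j) := fun i j =>
    (h i j).comp (contDiff_id.add contDiff_const)
  exact (contDiff_const.mul (hs _ _)).add (contDiff_const.mul (hs _ _))

/-- The curvature in the natural parameter is invariant, up to translation, under equivalence. -/
lemma Equivalent.range_curvature {γ γ' Γp Γm Γp' Γm' : Curve} {k k' : ℝ → ℝ}
    (h : IsSpinorFrame γ Γp Γm k fun _ => 1) (h' : IsSpinorFrame γ' Γp' Γm' k' fun _ => 1)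
    (he : Equivalent γ γ') : Set.range k = Set.range k' := by
  obtain ⟨c, A, B, hAB⟩ := he
  have sh : ContDiff ℝ ∞ fun s : ℝ => s + c := contDiff_id.add contDiff_const
  have hf : IsSpinorFrame γ' (fun s => A * Γp (s + c)) (fun s => B * Γm (s + c))
      (fun s => k (s + c)) fun _ => 1 :=
    { smooth_plus := h.smooth_plus.translate A c
      smooth_minus := h.smooth_minus.translate B c
      smooth_curvature := h.smooth_curvature.comp sh
      smooth_arc := contDiff_const
      arc_ne_zero := fun _ => one_ne_zero
      lift := fun t => by rw [hAB, h.lift]; group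
      plus := fun t => (h.hill_plus.translate A c).leftVelocity_eq t
      minus := fun t => (h.hill_minus.translate B c).leftVelocity_eq t }
  have hk : ∀ t, k (t + c) = k' t := fun t =>
    (spinorFrame_unique hf h' isOpen_univ (fun _ _ => rfl) (Set.mem_univ t)).2.2.2
  ext r
  constructor
  · rintro ⟨t, rfl⟩
    exact ⟨t - c, by rw [← hk, sub_add_cancel]⟩
  · rintro ⟨t, rfl⟩
    exact ⟨t + c, hk t⟩

/-! ### Trajectories with oscillating curvature -/

/-- Angular speed of the phase of the curvature `c - δ cos φ`. -/
noncomputable def phaseSpeed (m c δ u : ℝ) : ℝ := √(2 * (m - 3 * c + δ * Real.cos u))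

/-- The constant `√(-Q(p) / 2)`, where `Q` is the monic cubic with roots `m - 2 c` and `c ± δ`. -/
noncomputable def frameConst (m c δ p : ℝ) : ℝ :=
  √(((p - c) ^ 2 - δ ^ 2) * (m - 2 * c - p) / 2)

/-- The angle by which the frame with parameter `p` turns during one period of the curvature. -/
noncomputable def rotation (m c δ p : ℝ) : ℝ :=
  ∫ u in (0 : ℝ)..2 * Real.pi,
    frameConst m c δ p / ((p - c + δ * Real.cos u) * phaseSpeed m c δ u)

lemma abs_mul_cos_le {δ : ℝ} (hδ : 0 < δ) (u : ℝ) : -δ ≤ δ * Real.cos u ∧ δ * Real.cos u ≤ δ := by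
  constructor
  · nlinarith [Real.neg_one_le_cos u]
  · nlinarith [Real.cos_le_one u]

/-- The bounds on p place it between the two larger roots of Q, so that Q(p) < 0 and p - k > 0. Over
one period of the curvature the angle θ grows by `rotation`, while k and k' return to their values;
this gives the closing condition. -/
lemma exists_hillFrame {m c δ p T : ℝ} {φ k k₁ k₂ : ℝ → ℝ} (hδ : 0 < δ) (h₁ : c + δ < p)
    (h₂ : p < m - 2 * c)
    (hφ : ∀ t, HasDerivAt φ (phaseSpeed m c δ (φ t)) t)
    (hT : ∀ t, φ (t + T) = φ t + 2 * Real.pi) (hk : ∀ t, k t = c - δ * Real.cos (φ t))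
    (hk₁ : ∀ t, k₁ t = δ * Real.sin (φ t) * phaseSpeed m c δ (φ t))
    (hk₂ : ∀ t, k₂ t = 3 * k t ^ 2 - 2 * m * k t + (2 * c * (m - 2 * c) + c ^ 2 - δ ^ 2))
    (sk : ContDiff ℝ ∞ k) (sk₁ : ContDiff ℝ ∞ k₁)
    (dk : ∀ t, HasDerivAt k (k₁ t) t) (dk₁ : ∀ t, HasDerivAt k₁ (k₂ t) t) :
    ∃ Γ : Curve, IsSmooth Γ ∧ IsHillFrame Γ (fun t => k t + (p - m) / 2) (fun _ => 1) ∧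
      ∀ (n : ℕ) (a : ℤ), n * rotation m c δ p = a * (2 * Real.pi) →
        ∀ t, Γ (t + n * T) = Γ t := by
  have hS : ∀ u, 0 < 2 * (m - 3 * c + δ * Real.cos u) := fun u => by
    have := abs_mul_cos_le hδ u; linarith
  have hspos : ∀ u, 0 < phaseSpeed m c δ u := fun u => Real.sqrt_pos.2 (hS u)
  have hs2 : ∀ u, phaseSpeed m c δ u ^ 2 = 2 * (m - 3 * c + δ * Real.cos u) := fun u =>
    Real.sq_sqrt (hS u).le
  have hD : 0 < ((p - c) ^ 2 - δ ^ 2) * (m - 2 * c - p) / 2 := by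
    have : 0 < (p - c - δ) * (p - c + δ) * (m - 2 * c - p) :=
      mul_pos (mul_pos (by linarith) (by linarith)) (by linarith)
    nlinarith
  have hd : 0 < frameConst m c δ p := Real.sqrt_pos.2 hD
  have hd2 : frameConst m c δ p ^ 2 = ((p - c) ^ 2 - δ ^ 2) * (m - 2 * c - p) / 2 :=
    Real.sq_sqrt hD.le
  have hy0 : ∀ u, 0 < p - c + δ * Real.cos u := fun u => by
    have := abs_mul_cos_le hδ u; linarith
  have hy : ∀ t, 0 < p - k t := fun t => by rw [hk]; linarith [hy0 (φ t)]
  set q : ℝ → ℝ := fun u => frameConst m c δ p / ((p - c + δ * Real.cos u) * phaseSpeed m c δ u)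
    with hq
  have hqc : Continuous q := by
    refine continuous_const.div ?_ fun u => (mul_pos (hy0 u) (hspos u)).ne'
    unfold phaseSpeed
    fun_prop
  have hqp : Function.Periodic q (2 * Real.pi) := fun u => by
    simp only [hq, phaseSpeed, Real.cos_add_two_pi]
  have hqi : ∀ a b, IntervalIntegrable q MeasureTheory.volume a b := fun a b =>
    hqc.intervalIntegrable a b
  set θ : ℝ → ℝ := fun t => ∫ u in (0 : ℝ)..φ t, q u with hθ
  have dθ : ∀ t, HasDerivAt θ (frameConst m c δ p / (p - k t)) t := fun t => by
    have h := (intervalIntegral.integral_hasDerivAt_right (hqi 0 (φ t))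
      hqc.aestronglyMeasurable.stronglyMeasurableAtFilter hqc.continuousAt).comp t (hφ t)
    refine h.congr_deriv ?_
    have e1 := (hspos (φ t)).ne'
    have e2 := (hy0 (φ t)).ne'
    rw [hk, hq, show p - (c - δ * Real.cos (φ t)) = p - c + δ * Real.cos (φ t) by ring]
    field_simp
  have hθT : ∀ t, θ (t + T) = θ t + rotation m c δ p := fun t => by
    have h1 := hqp.intervalIntegral_add_eq_add 0 (φ t) hqi
    rw [zero_add] at h1
    simp only [hθ, hT]
    exact h1
  have sθ : ContDiff ℝ ∞ θ := by
    rw [contDiff_infty_iff_deriv]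
    refine ⟨fun t => (dθ t).differentiableAt, ?_⟩
    rw [show deriv θ = fun t => frameConst m c δ p / (p - k t) from funext fun t => (dθ t).deriv]
    exact contDiff_const.div (contDiff_const.sub sk) fun t => (hy t).ne'
  refine ⟨hillFrame p (frameConst m c δ p) k k₁ θ hd hy, isSmooth_hillFrame hd hy sk sk₁ sθ,
    isHillFrame_hillFrame hd hy dk dk₁ dθ fun t => ?_, fun n a hna t => ?_⟩
  -- Since k'² = 2Q(k) and k'' = Q'(k), the left side is half of the Taylor expansion of Q at k,
  -- evaluated at p; it equals Q(p)/2 = -d².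
  · rw [hd2, hk₁, mul_pow, mul_pow, hs2, Real.sin_sq, hk₂, hk]
    ring
  · have hper : ∀ j : ℕ, φ (t + j * T) = φ t + j * (2 * Real.pi) ∧
        θ (t + j * T) = θ t + j * rotation m c δ p := by
      intro j
      induction j with
      | zero => simp
      | succ j ih =>
        push_cast
        rw [show t + ((j : ℝ) + 1) * T = (t + j * T) + T by ring, hT, hθT, ih.1, ih.2]
        constructor <;> ring
    have e1 : k (t + n * T) = k t := by rw [hk, hk, (hper n).1, Real.cos_add_nat_mul_two_pi]
    have e2 : k₁ (t + n * T) = k₁ t := by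
      rw [hk₁, hk₁, (hper n).1, Real.sin_add_nat_mul_two_pi, phaseSpeed,
        Real.cos_add_nat_mul_two_pi, phaseSpeed]
    have e3 : Real.cos (θ (t + n * T)) = Real.cos (θ t) := by
      rw [(hper n).2, hna, Real.cos_add_int_mul_two_pi]
    have e4 : Real.sin (θ (t + n * T)) = Real.sin (θ t) := by
      rw [(hper n).2, hna, Real.sin_add_int_mul_two_pi]
    apply Subtype.ext
    simp only [hillFrame, e1, e2, e3, e4]

/-- For `δ > 0`, `c + δ < m - 2` and `c < -1` there is an extremal trajectory whose curvature
oscillates in `[c - δ, c + δ]`, closed when both rotation angles are rational. -/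
theorem exists_trajectory {m c δ : ℝ} (hδ : 0 < δ) (h₁ : c + δ < m - 2) (h₂ : c < -1) :
    ∃ (γ Γp Γm : Curve) (k : ℝ → ℝ), IsSpinorFrame γ Γp Γm k (fun _ => 1) ∧
      Set.range k = Set.Icc (c - δ) (c + δ) ∧ IsTrajectory m γ ∧
      ∀ (n : ℕ) (a b : ℤ), 0 < n → n * rotation m c δ (m + 2) = a * (2 * Real.pi) →
        n * rotation m c δ (m - 2) = b * (2 * Real.pi) → IsPeriodic γ := by
  have hS : ∀ u, 0 < 2 * (m - 3 * c + δ * Real.cos u) := fun u => by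
    have := abs_mul_cos_le hδ u; linarith
  have hspos : ∀ u, 0 < phaseSpeed m c δ u := fun u => Real.sqrt_pos.2 (hS u)
  have hs2 : ∀ u, phaseSpeed m c δ u ^ 2 = 2 * (m - 3 * c + δ * Real.cos u) := fun u =>
    Real.sq_sqrt (hS u).le
  have ss : ContDiff ℝ ∞ (phaseSpeed m c δ) :=
    (contDiff_const.mul (contDiff_const.add (contDiff_const.mul Real.contDiff_cos))).sqrt
      fun u => (hS u).ne'
  have ds : ∀ u, HasDerivAt (phaseSpeed m c δ) (-(δ * Real.sin u) / phaseSpeed m c δ u) u :=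
    fun u => by
    refine (((((Real.hasDerivAt_cos u).const_mul δ).const_add (m - 3 * c)).const_mul 2).sqrt
      (hS u).ne').congr_deriv ?_
    rw [← phaseSpeed]
    have := (hspos u).ne'
    field_simp
  obtain ⟨φ, T, hTpos, hφ, sφ, hT, hsurj⟩ := exists_phase Real.two_pi_pos ss hspos
    fun u => by simp [phaseSpeed]
  set k : ℝ → ℝ := fun t => c - δ * Real.cos (φ t) with hk
  set k₁ : ℝ → ℝ := fun t => δ * Real.sin (φ t) * phaseSpeed m c δ (φ t) with hk₁
  -- This is Q'(k), as obtained by differentiating k'² = 2Q(k).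
  set k₂ : ℝ → ℝ := fun t =>
    3 * k t ^ 2 - 2 * m * k t + (2 * c * (m - 2 * c) + c ^ 2 - δ ^ 2) with hk₂
  have sk : ContDiff ℝ ∞ k := contDiff_const.sub (contDiff_const.mul sφ.cos)
  have sk₁ : ContDiff ℝ ∞ k₁ := (contDiff_const.mul sφ.sin).mul (ss.comp sφ)
  have sk₂ : ContDiff ℝ ∞ k₂ := by fun_prop
  have dk : ∀ t, HasDerivAt k (k₁ t) t := fun t =>
    (((hφ t).cos.const_mul δ).const_sub c).congr_deriv (by simp only [hk₁]; ring)
  have dk₁ : ∀ t, HasDerivAt k₁ (k₂ t) t := fun t => by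
    refine (((hφ t).sin.const_mul δ).mul ((ds (φ t)).comp t (hφ t))).congr_deriv ?_
    have := (hspos (φ t)).ne'
    have e1 : -(δ * Real.sin (φ t)) / phaseSpeed m c δ (φ t) * phaseSpeed m c δ (φ t) =
      -(δ * Real.sin (φ t)) := by field_simp
    simp only [Function.comp_apply, hk₂, hk]
    rw [e1]
    linear_combination δ * Real.cos (φ t) * hs2 (φ t) - δ ^ 2 * Real.sin_sq (φ t)
  have dk₂ : ∀ t, HasDerivAt k₂ (6 * k t * k₁ t - 2 * m * k₁ t) t := fun t =>
    (((((dk t).pow 2).const_mul 3).sub ((dk t).const_mul (2 * m))).add_const _).congr_deriv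
      (by simp; ring)
  -- The values p = m ± 2 turn k + (p - m)/2 into k ± 1. The condition p < m - 2c at p = m + 2 is c
  -- < -1, and c + δ < p at p = m - 2 is `h₁`; the other two bounds follow.
  obtain ⟨Γp, sp, fp, pp⟩ := exists_hillFrame (p := m + 2) hδ (by linarith) (by linarith) hφ hT
    (fun _ => rfl) (fun _ => rfl) (fun _ => rfl) sk sk₁ dk dk₁
  obtain ⟨Γm, sm, fm, pm⟩ := exists_hillFrame (p := m - 2) hδ (by linarith) (by linarith) hφ hT
    (fun _ => rfl) (fun _ => rfl) (fun _ => rfl) sk sk₁ dk dk₁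
  have hframe : IsSpinorFrame (fun t => Γp t * (Γm t)⁻¹) Γp Γm k fun _ => 1 :=
    { smooth_plus := sp
      smooth_minus := sm
      smooth_curvature := sk
      smooth_arc := contDiff_const
      arc_ne_zero := fun _ => one_ne_zero
      lift := fun _ => rfl
      plus := fun t => by rw [fp.leftVelocity_eq t]; congr 5; ring
      minus := fun t => by rw [fm.leftVelocity_eq t]; congr 5; ring }
  have hrange : Set.range k = Set.Icc (c - δ) (c + δ) := by
    ext r
    constructor
    · rintro ⟨t, rfl⟩
      have := abs_mul_cos_le hδ (φ t)
      exact ⟨by simp only [hk]; linarith, by simp only [hk]; linarith⟩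
    · rintro ⟨hr1, hr2⟩
      obtain ⟨t, ht⟩ := hsurj (Real.arccos ((c - r) / δ))
      refine ⟨t, ?_⟩
      simp only [hk, ht]
      rw [Real.cos_arccos (by rw [le_div_iff₀ hδ]; linarith) (by rw [div_le_iff₀ hδ]; linarith)]
      field_simp
      ring
  refine ⟨_, Γp, Γm, k, hframe, hrange, ⟨hframe.isNullCurve, hframe.noFlex,
    ⟨Γp, Γm, k, hframe, ?_⟩, hframe.isCritical sk₁ sk₂ dk dk₁ dk₂⟩, fun n a b hn ha hb => ?_⟩
  · rintro ⟨r, hr⟩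
    have m1 : c - δ ∈ Set.range k := by rw [hrange]; exact ⟨le_rfl, by linarith⟩
    have m2 : c + δ ∈ Set.range k := by rw [hrange]; exact ⟨by linarith, le_rfl⟩
    obtain ⟨t1, e1⟩ := m1
    obtain ⟨t2, e2⟩ := m2
    rw [hr] at e1 e2
    linarith
  · refine ⟨n * T, by positivity, fun t => ?_⟩
    simp only [pp n a ha t, pm n b hb t]

/-! ### The rotation integral -/

/-- Twice the rotation angle, as a function of the parameters `ρ = (p - c) / (m - 2 c - p)` and
`τ = δ / (p - c)`. -/
noncomputable def rotationIntegral (ρ τ : ℝ) : ℝ :=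
  ∫ ψ in (0 : ℝ)..2 * Real.pi, (√(1 + ρ * ((1 - τ ^ 2) / (1 - τ * Real.cos ψ))))⁻¹

lemma one_sub_mul_cos_pos {τ : ℝ} (h0 : 0 ≤ τ) (h1 : τ < 1) (u : ℝ) :
    0 < 1 - τ * Real.cos u := by nlinarith [Real.cos_le_one u]

lemma one_add_mul_cos_pos {τ : ℝ} (h0 : 0 ≤ τ) (h1 : τ < 1) (u : ℝ) :
    0 < 1 + τ * Real.cos u := by nlinarith [Real.neg_one_le_cos u]

lemma one_sub_sq_pos {τ : ℝ} (h0 : 0 ≤ τ) (h1 : τ < 1) : 0 < 1 - τ ^ 2 := by nlinarith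

/-- This is Kepler's change from the true anomaly u to the eccentric anomaly E on an ellipse of
eccentricity τ. The form E = u - 2 arctan(β sin u / (1 + β cos u)), with β = τ/(1 + √(1 - τ²)), is
smooth on the whole line, unlike the half-angle formula. -/
lemma exists_anomaly {τ : ℝ} (h0 : 0 ≤ τ) (h1 : τ < 1) :
    ∃ E : ℝ → ℝ, E 0 = 0 ∧ E (2 * Real.pi) = 2 * Real.pi ∧
      (∀ u, HasDerivAt E (√(1 - τ ^ 2) / (1 + τ * Real.cos u)) u) ∧
      ∀ u, (1 - τ ^ 2) / (1 - τ * Real.cos (E u)) = 1 + τ * Real.cos u := by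
  have hs2 := Real.sq_sqrt (one_sub_sq_pos h0 h1).le
  have hs0 := Real.sqrt_pos.2 (one_sub_sq_pos h0 h1)
  set s := √(1 - τ ^ 2)
  obtain ⟨β, hβ⟩ : ∃ β, β = τ / (1 + s) := ⟨_, rfl⟩
  have hβ' : β * (1 + s) = τ := by rw [hβ]; field_simp
  have hβ2 : β ^ 2 * (1 + s) = 1 - s := by
    rw [hβ]; field_simp; linarith
  have hβ0 : 0 ≤ β := by rw [hβ]; positivity
  have hβ1 : β < 1 := by rw [hβ, div_lt_one (by positivity)]; linarith
  have hτβ : τ * (1 + β ^ 2) = 2 * β := by linear_combination (-(1 + β ^ 2)) * hβ' + β * hβ2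
  have hsβ : s * (1 + β ^ 2) = 1 - β ^ 2 := by linear_combination hβ2
  have hq : 0 < 1 + β ^ 2 := by positivity
  have hden : ∀ u, 0 < 1 + β * Real.cos u := one_add_mul_cos_pos hβ0 hβ1
  have hτu : ∀ u, 0 < 1 + τ * Real.cos u := one_add_mul_cos_pos h0 h1
  -- The left side is |1 + β exp(iu)|², and x below is the tangent of the argument of 1 + β exp(iu).
  have hN : ∀ u, (1 + β * Real.cos u) ^ 2 + (β * Real.sin u) ^ 2 =
      (1 + β ^ 2) * (1 + τ * Real.cos u) := fun u => by
    linear_combination β ^ 2 * Real.sin_sq_add_cos_sq u - Real.cos u * hτβ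
  set x : ℝ → ℝ := fun u => β * Real.sin u / (1 + β * Real.cos u) with hx
  have hx2 : ∀ u, 1 + x u ^ 2 = (1 + β ^ 2) * (1 + τ * Real.cos u) / (1 + β * Real.cos u) ^ 2 :=
    fun u => by
    have := (hden u).ne'
    rw [← hN, hx]
    field_simp
  refine ⟨fun u => u - 2 * Real.arctan (x u), by simp [hx], by simp [hx], fun u => ?_, fun u => ?_⟩
  · have dx : HasDerivAt x _ u := ((Real.hasDerivAt_sin u).const_mul β).div
      (((Real.hasDerivAt_cos u).const_mul β).const_add 1) (hden u).ne'
    refine ((hasDerivAt_id u).sub (dx.arctan.const_mul 2)).congr_deriv ?_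
    rw [hx2]
    have e1 := (hden u).ne'
    have e2 := (hτu u).ne'
    field_simp
    have h3 := Real.sin_sq_add_cos_sq u
    linear_combination Real.cos u * hτβ - 2 * β ^ 2 * h3 - hsβ
  · have ec : Real.cos (u - 2 * Real.arctan (x u)) =
        (Real.cos u + τ) / (1 + τ * Real.cos u) := by
      have hpos : 0 < 1 + x u ^ 2 := by positivity
      have c2 : Real.cos (2 * Real.arctan (x u)) = 2 / (1 + x u ^ 2) - 1 := by
        rw [Real.cos_two_mul, Real.cos_sq_arctan]; ring
      have s2 : Real.sin (2 * Real.arctan (x u)) = 2 * x u / (1 + x u ^ 2) := by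
        rw [Real.sin_two_mul, Real.sin_arctan, Real.cos_arctan]
        have := Real.sq_sqrt hpos.le
        have h' := (Real.sqrt_pos.2 hpos).ne'
        field_simp
        rw [this]
      rw [Real.cos_sub, c2, s2, hx2]
      simp only [hx]
      have e1 := (hden u).ne'
      have e2 : 1 + Real.cos u * τ ≠ 0 := by rw [mul_comm]; exact (hτu u).ne'
      field_simp
      have h3 := Real.sin_sq_add_cos_sq u
      linear_combination (2 * β + 2 * β ^ 2 * Real.cos u) * h3 + (-Real.cos u ^ 2 - 1) * hτβ
    rw [ec]
    have e2 := (hτu u).ne'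
    have e3 : 1 - τ * ((Real.cos u + τ) / (1 + τ * Real.cos u)) =
      (1 - τ ^ 2) / (1 + τ * Real.cos u) := by field_simp; ring
    have e4 := (one_sub_sq_pos h0 h1).ne'
    rw [e3]
    field_simp

lemma integral_anomaly {τ : ℝ} (h0 : 0 ≤ τ) (h1 : τ < 1) {F : ℝ → ℝ}
    (hF : ContinuousOn F (Set.Ioi 0)) :
    ∫ u in (0 : ℝ)..2 * Real.pi, F (1 + τ * Real.cos u) * (√(1 - τ ^ 2) / (1 + τ * Real.cos u)) =
      ∫ ψ in (0 : ℝ)..2 * Real.pi, F ((1 - τ ^ 2) / (1 - τ * Real.cos ψ)) := by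
  obtain ⟨E, E0, E1, dE, hE⟩ := exists_anomaly h0 h1
  have hc : Continuous fun ψ => F ((1 - τ ^ 2) / (1 - τ * Real.cos ψ)) := by
    refine hF.comp_continuous (f := fun ψ => (1 - τ ^ 2) / (1 - τ * Real.cos ψ))
      (continuous_const.div (by fun_prop) fun ψ => (one_sub_mul_cos_pos h0 h1 ψ).ne')
      fun ψ => div_pos (one_sub_sq_pos h0 h1) (one_sub_mul_cos_pos h0 h1 ψ)
  have := intervalIntegral.integral_comp_mul_deriv (a := 0) (b := 2 * Real.pi) (f := E)
    (g := fun ψ => F ((1 - τ ^ 2) / (1 - τ * Real.cos ψ))) (fun u _ => dE u)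
    (Continuous.continuousOn (continuous_const.div (by fun_prop)
      fun u => (one_add_mul_cos_pos h0 h1 u).ne')) hc
  rw [E0, E1] at this
  rw [← this]
  simp only [Function.comp_apply, hE]

/-- The eccentric anomaly absorbs the factor √(1 - τ²)/(1 + τ cos u), which degenerates as τ → 1.
What remains is bounded by 1 and can be followed up to τ = 1. -/
lemma rotation_eq {m c δ p : ℝ} (hδ : 0 < δ) (h₁ : c + δ < p) (h₂ : p < m - 2 * c) :
    rotation m c δ p = rotationIntegral ((p - c) / (m - 2 * c - p)) (δ / (p - c)) / 2 := by
  set b := p - c with hb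
  set e := m - 2 * c - p with he
  have hbpos : 0 < b := by linarith
  have hepos : 0 < e := by linarith
  have h0 : 0 ≤ δ / b := by positivity
  have h1 : δ / b < 1 := by rw [div_lt_one hbpos]; linarith
  set τ := δ / b with hτ
  have hδτ : δ = b * τ := by rw [hτ]; field_simp
  have hF : ContinuousOn (fun x : ℝ => (√(1 + b / e * x))⁻¹) (Set.Ioi 0) := by
    refine ContinuousOn.inv₀ (by fun_prop) fun x (hx : 0 < x) => ?_
    positivity
  rw [rotationIntegral, ← integral_anomaly h0 h1 hF, rotation, ← intervalIntegral.integral_div]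
  congr 1
  ext u
  have e1 := one_add_mul_cos_pos h0 h1 u
  have d1 : frameConst m c δ p = b * √(1 - τ ^ 2) * √(e / 2) := by
    rw [frameConst, ← hb, ← he, hδτ, show (b ^ 2 - (b * τ) ^ 2) * e / 2 =
      b ^ 2 * ((1 - τ ^ 2) * (e / 2)) by ring, Real.sqrt_mul (sq_nonneg b), Real.sqrt_sq hbpos.le,
      Real.sqrt_mul (one_sub_sq_pos h0 h1).le]
    ring
  have d2 : phaseSpeed m c δ u = 2 * √(e / 2) * √(1 + b / e * (1 + τ * Real.cos u)) := by
    rw [phaseSpeed, show 2 * (m - 3 * c + δ * Real.cos u) =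
      2 ^ 2 * ((e / 2) * (1 + b / e * (1 + τ * Real.cos u))) by
        rw [hδτ]; field_simp; rw [hb, he]; ring, Real.sqrt_mul (by norm_num),
      Real.sqrt_sq (by norm_num), Real.sqrt_mul (by positivity)]
    ring
  have d3 : 0 < √(e / 2) := Real.sqrt_pos.2 (by positivity)
  have d4 : 0 < √(1 + b / e * (1 + τ * Real.cos u)) := Real.sqrt_pos.2 (by positivity)
  rw [d1, d2, hδτ, show b + b * τ * Real.cos u = b * (1 + τ * Real.cos u) by ring]
  generalize √(e / 2) = x at *
  generalize √(1 + b / e * (1 + τ * Real.cos u)) = y at *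
  field_simp

lemma rotationIntegral_zero (ρ : ℝ) : rotationIntegral ρ 0 = 2 * Real.pi * (√(1 + ρ))⁻¹ := by
  simp [rotationIntegral]

/-- The numerator 1 - τ² is zero, and the convention 0/0 = 0 covers cos ψ = 1, so the integrand is 1
everywhere. -/
lemma rotationIntegral_one (ρ : ℝ) : rotationIntegral ρ 1 = 2 * Real.pi := by
  simp [rotationIntegral]

lemma integrand_continuous {ρ τ : ℝ} (hρ : 0 < ρ) (h0 : 0 ≤ τ) (h1 : τ < 1) :
    Continuous fun ψ => (√(1 + ρ * ((1 - τ ^ 2) / (1 - τ * Real.cos ψ))))⁻¹ := by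
  have hp := one_sub_mul_cos_pos h0 h1
  have hq := one_sub_sq_pos h0 h1
  refine Continuous.inv₀ (Continuous.sqrt (continuous_const.add (continuous_const.mul
    (continuous_const.div (by fun_prop) fun ψ => (hp ψ).ne')))) fun ψ => ?_
  have := hp ψ
  positivity

lemma rotationIntegral_strictAnti {τ ρ ρ' : ℝ} (h0 : 0 ≤ τ) (h1 : τ < 1) (hρ : 0 < ρ)
    (hlt : ρ < ρ') : rotationIntegral ρ' τ < rotationIntegral ρ τ := by
  have hlt' : ∀ ψ, (√(1 + ρ' * ((1 - τ ^ 2) / (1 - τ * Real.cos ψ))))⁻¹ <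
      (√(1 + ρ * ((1 - τ ^ 2) / (1 - τ * Real.cos ψ))))⁻¹ := fun ψ => by
    have h2 : 0 < (1 - τ ^ 2) / (1 - τ * Real.cos ψ) :=
      div_pos (one_sub_sq_pos h0 h1) (one_sub_mul_cos_pos h0 h1 ψ)
    have h3 : 0 < √(1 + ρ * ((1 - τ ^ 2) / (1 - τ * Real.cos ψ))) := by positivity
    gcongr
  exact intervalIntegral.integral_lt_integral_of_continuousOn_of_le_of_exists_lt Real.two_pi_pos
    (integrand_continuous (hρ.trans hlt) h0 h1).continuousOn
    (integrand_continuous hρ h0 h1).continuousOn (fun ψ _ => (hlt' ψ).le)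
    ⟨0, ⟨le_rfl, Real.two_pi_pos.le⟩, hlt' 0⟩

lemma rotationIntegral_le {τ ρ : ℝ} (h0 : 0 ≤ τ) (h1 : τ < 1) (hρ : 0 < ρ) :
    rotationIntegral ρ τ ≤ 2 * Real.pi * (√(1 + ρ * (1 - τ)))⁻¹ := by
  have h2 : rotationIntegral ρ τ ≤ ∫ _ in (0 : ℝ)..2 * Real.pi, (√(1 + ρ * (1 - τ)))⁻¹ := by
    refine intervalIntegral.integral_mono_on Real.two_pi_pos.le
      ((integrand_continuous hρ h0 h1).intervalIntegrable _ _)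
      (continuous_const.intervalIntegrable _ _) fun ψ _ => ?_
    have h3 : 1 - τ ≤ (1 - τ ^ 2) / (1 - τ * Real.cos ψ) := by
      rw [le_div_iff₀ (one_sub_mul_cos_pos h0 h1 ψ)]
      have : 0 ≤ (1 - τ) * (τ * (1 + Real.cos ψ)) :=
        mul_nonneg (by linarith) (mul_nonneg h0 (by linarith [Real.neg_one_le_cos ψ]))
      nlinarith
    have h4 : 0 < 1 - τ := by linarith
    have h5 : 0 < √(1 + ρ * (1 - τ)) := by positivity
    gcongr
  simpa using h2

lemma inv_sqrt_tangent {x a : ℝ} (hx : 0 < x) (ha : 0 < a) :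
    (√a)⁻¹ - (x - a) * (2 * a * √a)⁻¹ ≤ (√x)⁻¹ := by
  obtain ⟨r, hr, rfl⟩ : ∃ r : ℝ, 0 < r ∧ x = r ^ 2 :=
    ⟨√x, Real.sqrt_pos.2 hx, (Real.sq_sqrt hx.le).symm⟩
  obtain ⟨s, hs, rfl⟩ : ∃ r : ℝ, 0 < r ∧ a = r ^ 2 :=
    ⟨√a, Real.sqrt_pos.2 ha, (Real.sq_sqrt ha.le).symm⟩
  rw [Real.sqrt_sq hr.le, Real.sqrt_sq hs.le]
  have : r⁻¹ - (s⁻¹ - (r ^ 2 - s ^ 2) * (2 * s ^ 2 * s)⁻¹) =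
      (r - s) ^ 2 * (r + 2 * s) / (2 * s ^ 3 * r) := by field_simp; ring
  have h2 : 0 ≤ (r - s) ^ 2 * (r + 2 * s) / (2 * s ^ 3 * r) := by positivity
  linarith

/-- Jensen's inequality, through the tangent line of the convex function x ↦ x^(-1/2) at 1 + ρ: the
mean of (1 - τ²)/(1 - τ cos ψ) is √(1 - τ²) ≤ 1. -/
lemma le_rotationIntegral {τ ρ : ℝ} (h0 : 0 ≤ τ) (h1 : τ < 1) (hρ : 0 < ρ) :
    2 * Real.pi * (√(1 + ρ))⁻¹ ≤ rotationIntegral ρ τ := by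
  have hq := one_sub_sq_pos h0 h1
  have hσc : Continuous fun ψ => (1 - τ ^ 2) / (1 - τ * Real.cos ψ) :=
    continuous_const.div (by fun_prop) fun ψ => (one_sub_mul_cos_pos h0 h1 ψ).ne'
  have hσ : ∫ ψ in (0 : ℝ)..2 * Real.pi, (1 - τ ^ 2) / (1 - τ * Real.cos ψ) ≤ 2 * Real.pi := by
    have h2 := integral_anomaly h0 h1 (F := fun x => x) continuousOn_id
    rw [← h2]
    have h3 : ∀ u, (1 + τ * Real.cos u) * (√(1 - τ ^ 2) / (1 + τ * Real.cos u)) = √(1 - τ ^ 2) :=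
      fun u => by have := (one_add_mul_cos_pos h0 h1 u).ne'; field_simp
    simp only [h3]
    have h4 : √(1 - τ ^ 2) ≤ 1 := Real.sqrt_le_one.2 (by nlinarith)
    simp only [intervalIntegral.integral_const, sub_zero, smul_eq_mul]
    nlinarith [Real.pi_pos]
  set a := 1 + ρ with ha
  have h2 : ∫ ψ in (0 : ℝ)..2 * Real.pi, ((√a)⁻¹ + ρ * (2 * a * √a)⁻¹ -
      ρ * (2 * a * √a)⁻¹ * ((1 - τ ^ 2) / (1 - τ * Real.cos ψ))) ≤ rotationIntegral ρ τ := by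
    refine intervalIntegral.integral_mono_on Real.two_pi_pos.le
      (Continuous.intervalIntegrable (continuous_const.sub (continuous_const.mul hσc)) _ _)
      ((integrand_continuous hρ h0 h1).intervalIntegrable _ _) fun ψ _ => ?_
    have hσ0 := div_pos hq (one_sub_mul_cos_pos h0 h1 ψ)
    refine le_trans (le_of_eq ?_) (inv_sqrt_tangent (a := a) (by positivity) (by positivity))
    rw [ha]; ring
  rw [intervalIntegral.integral_sub (continuous_const.intervalIntegrable _ _)
    ((hσc.intervalIntegrable _ _).const_mul _), intervalIntegral.integral_const,
    intervalIntegral.integral_const_mul] at h2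
  have h3 : 0 < ρ * (2 * a * √a)⁻¹ := by positivity
  simp only [sub_zero, smul_eq_mul] at h2
  nlinarith

lemma continuousOn_rotationIntegral :
    ContinuousOn (fun x : ℝ × ℝ => rotationIntegral x.1 x.2) (Set.Ioi 0 ×ˢ Set.Icc 0 1) := by
  rintro ⟨ρ₀, τ₀⟩ hx
  have hσ : ∀ x ∈ (Set.Ioi 0 ×ˢ Set.Icc 0 1 : Set (ℝ × ℝ)), ∀ ψ,
      0 ≤ x.1 * ((1 - x.2 ^ 2) / (1 - x.2 * Real.cos ψ)) := by
    rintro ⟨ρ, τ⟩ ⟨h1, h2, h3⟩ ψ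
    simp only [Set.mem_Ioi] at h1 h2 h3 ⊢
    exact mul_nonneg h1.le (div_nonneg (by nlinarith) (by nlinarith [Real.cos_le_one ψ]))
  refine intervalIntegral.continuousWithinAt_of_dominated_interval (bound := fun _ => 1) ?_ ?_
    (continuous_const.intervalIntegrable _ _) ?_
  · refine Filter.Eventually.of_forall fun x => Measurable.aestronglyMeasurable ?_
    fun_prop
  · filter_upwards [self_mem_nhdsWithin] with x hx
    refine Filter.Eventually.of_forall fun ψ _ => ?_
    have := hσ x hx ψ
    rw [norm_inv, Real.norm_of_nonneg (Real.sqrt_nonneg _)]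
    exact inv_le_one_of_one_le₀ (Real.one_le_sqrt.2 (by linarith))
  · have hne : ∀ᵐ ψ : ℝ, ψ ≠ 2 * Real.pi := by simp [MeasureTheory.ae_iff]
    filter_upwards [hne] with ψ hψ hmem
    rw [Set.uIoc_of_le Real.two_pi_pos.le] at hmem
    have hcos : Real.cos ψ < 1 := by
      refine lt_of_le_of_ne (Real.cos_le_one ψ) fun h => ?_
      rw [Real.cos_eq_one_iff_of_lt_of_lt (by linarith [hmem.1, Real.pi_pos])
        (lt_of_le_of_ne hmem.2 hψ)] at h
      exact hmem.1.ne' h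
    have hx' := hx
    obtain ⟨h1, h2, h3⟩ := hx'
    simp only [Set.mem_Ioi] at h1 h2 h3
    have hden : 1 - τ₀ * Real.cos ψ ≠ 0 := by
      rcases h2.eq_or_lt with h | h
      · rw [← h]; norm_num
      · nlinarith
    have hs := hσ _ hx ψ
    simp only at hs
    have hsq : √(1 + ρ₀ * ((1 - τ₀ ^ 2) / (1 - τ₀ * Real.cos ψ))) ≠ 0 := by positivity
    refine ContinuousAt.continuousWithinAt (ContinuousAt.inv₀ (Real.continuous_sqrt.continuousAt.comp
      (ContinuousAt.add continuousAt_const (ContinuousAt.mul continuousAt_fst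
        (ContinuousAt.div (by fun_prop) (by fun_prop) hden)))) hsq)

/-! ### Level curves of the first rotation angle -/

open Set Filter Topology

lemma continuousOn_rotationIntegral_comp {f g : ℝ → ℝ} {s : Set ℝ} (hf : ContinuousOn f s)
    (hg : ContinuousOn g s) (h : ∀ t ∈ s, 0 < f t ∧ 0 ≤ g t ∧ g t ≤ 1) :
    ContinuousOn (fun t => rotationIntegral (f t) (g t)) s :=
  continuousOn_rotationIntegral.comp (hf.prodMk hg) fun t ht =>
    ⟨(h t ht).1, (h t ht).2.1, (h t ht).2.2⟩

/-- The level curve of `rotationIntegral` through `(ρ₀, 0)` is a graph over `[0, 1)`. -/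
lemma exists_level_curve {ρ₀ : ℝ} (hρ₀ : 0 < ρ₀) :
    ∃ r : ℝ → ℝ, r 0 = ρ₀ ∧ ContinuousOn r (Ico 0 1) ∧
      ∀ τ ∈ Ico (0 : ℝ) 1, ρ₀ ≤ r τ ∧ rotationIntegral (r τ) τ = rotationIntegral ρ₀ 0 := by
  have hex : ∀ τ : ℝ, ∃ ρ, τ ∈ Ico (0 : ℝ) 1 →
      ρ₀ ≤ ρ ∧ rotationIntegral ρ τ = rotationIntegral ρ₀ 0 := by
    intro τ
    by_cases hτ : τ ∈ Ico (0 : ℝ) 1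
    · obtain ⟨h0, h1⟩ := hτ
      have h1' : 0 < 1 - τ := by linarith
      have hle : ρ₀ ≤ ρ₀ / (1 - τ) := by
        rw [le_div_iff₀ h1']; nlinarith
      have hc : ContinuousOn (fun ρ => rotationIntegral ρ τ) (Icc ρ₀ (ρ₀ / (1 - τ))) :=
        continuousOn_rotationIntegral_comp continuousOn_id continuousOn_const
          fun t ht => ⟨hρ₀.trans_le ht.1, h0, h1.le⟩
      -- The upper bound `rotationIntegral_le` at ρ₀/(1 - τ) is exactly the level 2π/√(1 + ρ₀), and
      -- Jensen's bound at ρ₀ is the same number.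
      have hmem : rotationIntegral ρ₀ 0 ∈
          Icc (rotationIntegral (ρ₀ / (1 - τ)) τ) (rotationIntegral ρ₀ τ) := by
        rw [rotationIntegral_zero]
        refine ⟨?_, le_rotationIntegral h0 h1 hρ₀⟩
        have := rotationIntegral_le h0 h1 (hρ₀.trans_le hle)
        rwa [div_mul_cancel₀ _ h1'.ne'] at this
      obtain ⟨ρ, hρ, he⟩ := intermediate_value_Icc' hle hc hmem
      exact ⟨ρ, fun _ => ⟨hρ.1, he⟩⟩
    · exact ⟨0, fun h => absurd h hτ⟩
  choose r hr using hex
  refine ⟨r, ?_, ?_, hr⟩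
  · obtain ⟨h1, h2⟩ := hr 0 ⟨le_rfl, one_pos⟩
    rcases h1.eq_or_lt with h | h
    · exact h.symm
    · exact absurd h2 (rotationIntegral_strictAnti le_rfl one_pos hρ₀ h).ne
  · intro τ₀ hτ₀
    have hcont : ∀ a, 0 < a →
        Tendsto (fun τ => rotationIntegral a τ) (𝓝[Ico 0 1] τ₀) (𝓝 (rotationIntegral a τ₀)) :=
      fun a ha => continuousOn_rotationIntegral_comp (s := Ico 0 1) continuousOn_const continuousOn_id
        (fun t ht => ⟨ha, ht.1, ht.2.le⟩) τ₀ hτ₀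
    obtain ⟨hle, heq⟩ := hr τ₀ hτ₀
    -- By strict monotonicity in ρ, comparing a > 0 with r(τ) amounts to comparing R(a, τ) with the
    -- level, and a strict inequality there is an open condition in τ.
    refine tendsto_order.2 ⟨fun a ha => ?_, fun a ha => ?_⟩
    · rcases le_or_gt a 0 with h | h
      · filter_upwards [self_mem_nhdsWithin] with τ hτ
        exact h.trans_lt (hρ₀.trans_le (hr τ hτ).1)
      · have h1 := rotationIntegral_strictAnti hτ₀.1 hτ₀.2 h ha
        rw [heq] at h1
        filter_upwards [self_mem_nhdsWithin, (hcont a h).eventually (lt_mem_nhds h1)] with τ hτ h2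
        by_contra! h3
        obtain ⟨h4, h5⟩ := hr τ hτ
        rcases h3.eq_or_lt with h6 | h6
        · rw [← h6, h5] at h2; exact lt_irrefl _ h2
        · have := rotationIntegral_strictAnti hτ.1 hτ.2 (hρ₀.trans_le h4) h6
          linarith
    · have hpos : 0 < r τ₀ := hρ₀.trans_le hle
      have h1 := rotationIntegral_strictAnti hτ₀.1 hτ₀.2 hpos ha
      rw [heq] at h1
      filter_upwards [self_mem_nhdsWithin,
        (hcont a (hpos.trans ha)).eventually (gt_mem_nhds h1)] with τ hτ h2
      by_contra! h3
      obtain ⟨h4, h5⟩ := hr τ hτ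
      rcases h3.eq_or_lt with h6 | h6
      · rw [h6, h5] at h2; exact lt_irrefl _ h2
      · have := rotationIntegral_strictAnti hτ.1 hτ.2 (hpos.trans ha) h6
        linarith

/-- A continuous function that is positive at `0` and nonpositive somewhere in `(0, 1)` has a
first zero. -/
lemma exists_first_zero {H : ℝ → ℝ} (hc : ContinuousOn H (Ico 0 1)) (h0 : 0 < H 0)
    {t : ℝ} (ht : t ∈ Ico (0 : ℝ) 1) (hH : H t ≤ 0) :
    ∃ τ ∈ Ioo (0 : ℝ) 1, H τ = 0 ∧ ∀ s ∈ Ico 0 τ, 0 < H s := by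
  have hc' : ContinuousOn H (Icc 0 t) := hc.mono fun s hs => ⟨hs.1, hs.2.trans_lt ht.2⟩
  have hcl : IsCompact (Icc 0 t ∩ H ⁻¹' Iic 0) :=
    isCompact_Icc.of_isClosed_subset (hc'.preimage_isClosed_of_isClosed isClosed_Icc isClosed_Iic)
      inter_subset_left
  obtain ⟨τ, ⟨hτ1, hτ2⟩, hmin⟩ := hcl.exists_isLeast ⟨t, ⟨ht.1, le_rfl⟩, hH⟩
  have hpos : ∀ s ∈ Ico 0 τ, 0 < H s := fun s hs => by
    by_contra! h
    exact absurd (hmin ⟨⟨hs.1, hs.2.le.trans hτ1.2⟩, h⟩) (not_le.2 hs.2)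
  have hτ0 : 0 < τ := lt_of_le_of_ne hτ1.1 fun h => by
    rw [← h] at hτ2; exact absurd hτ2 (not_le.2 h0)
  refine ⟨τ, ⟨hτ0, hτ1.2.trans_lt ht.2⟩, le_antisymm hτ2 ?_, hpos⟩
  have hmem : τ ∈ closure (Ico 0 τ) := by
    rw [closure_Ico hτ0.ne]; exact ⟨hτ0.le, le_rfl⟩
  have hcw : ContinuousWithinAt H (Ico 0 τ) τ :=
    (hc' τ hτ1).mono fun s hs => ⟨hs.1, hs.2.le.trans hτ1.2⟩
  have := hcw.mem_closure_image hmem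
  have hsub : H '' Ico 0 τ ⊆ Ici 0 := by
    rintro _ ⟨s, hs, rfl⟩
    exact (hpos s hs).le
  exact closure_minimal hsub isClosed_Ici this

/-- The rotation of the second spinor component is not constant along a level curve of the rotation
of the first one. In terms of `ρ` and `L = (2 ρ - 1) / (m + 3)` the trajectory parameters are
`c = -1 - 1 / L` and `δ = 2 τ ρ / L`. -/
lemma exists_path {m ρ₀ : ℝ} (hm : m + 3 ≠ 0) (hρ₀ : 0 < ρ₀) (hL₀ : 0 < (2 * ρ₀ - 1) / (m + 3))
    (hρL : 2 * ((2 * ρ₀ - 1) / (m + 3)) < ρ₀) :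
    ∃ (r L Ψ : ℝ → ℝ) (τ₁ : ℝ), 0 < τ₁ ∧ ContinuousOn Ψ (Icc 0 τ₁) ∧ Ψ 0 ≠ Ψ τ₁ ∧
      ∀ τ ∈ Ioo 0 τ₁, τ < 1 ∧ 0 < r τ ∧ 0 < L τ ∧ 2 * r τ - 1 = L τ * (m + 3) ∧
        2 * L τ < r τ * (1 - τ) ∧ rotationIntegral (r τ) τ = rotationIntegral ρ₀ 0 ∧
        Ψ τ = rotationIntegral ((r τ - 2 * L τ) / (1 + 2 * L τ)) (τ * r τ / (r τ - 2 * L τ)) := by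
  obtain ⟨r, r0, rc, hr⟩ := exists_level_curve hρ₀
  set L : ℝ → ℝ := fun τ => (2 * r τ - 1) / (m + 3) with hL
  have Lc : ContinuousOn L (Ico 0 1) := ((continuousOn_const.mul rc).sub continuousOn_const).div_const _
  have hLr : ∀ τ, 2 * r τ - 1 = L τ * (m + 3) := fun τ => by
    simp only [hL]; field_simp
  have L0 : L 0 = (2 * ρ₀ - 1) / (m + 3) := by simp only [hL, r0]
  rw [← L0] at hL₀ hρL
  -- Positivity of H means L > 0, that is c < -1, together with c + δ < m - 2. The path stops at the
  -- first zero of H.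
  set H : ℝ → ℝ := fun τ => min (L τ) (r τ * (1 - τ) - 2 * L τ) with hH
  have Hc : ContinuousOn H (Ico 0 1) :=
    ContinuousOn.inf Lc ((rc.mul (by fun_prop)).sub (continuousOn_const.mul Lc))
  have H0 : 0 < H 0 := lt_min hL₀ (by rw [r0]; linarith)
  have hex : ∃ t ∈ Ico (0 : ℝ) 1, H t ≤ 0 := by
    -- If m + 3 < 0, then R(1/2, τ) → 2π as τ → 1 exceeds the level, so r > 1/2 and hence L < 0 near
    -- τ = 1. If m + 3 > 0, then r ≥ ρ₀ gives L/r ≥ L(0)/ρ₀, and the second entry of H is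
    -- nonpositive at τ = 1 - 2L(0)/ρ₀.
    rcases lt_or_gt_of_ne hm with hneg | hpos
    · have hc : Tendsto (fun τ => rotationIntegral (1 / 2) τ) (𝓝[Ico 0 1] 1)
          (𝓝 (rotationIntegral (1 / 2) 1)) :=
        (continuousOn_rotationIntegral_comp (s := Icc 0 1) continuousOn_const continuousOn_id
          (fun t ht => ⟨by norm_num, ht.1, ht.2⟩) 1 ⟨zero_le_one, le_rfl⟩).mono Ico_subset_Icc_self
      have hlt : rotationIntegral ρ₀ 0 < rotationIntegral (1 / 2) 1 := by
        rw [rotationIntegral_zero, rotationIntegral_one]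
        have h1 : (√(1 + ρ₀))⁻¹ < 1 := inv_lt_one_of_one_lt₀ (by
          rw [Real.lt_sqrt zero_le_one]; linarith)
        nlinarith [Real.pi_pos]
      have : (𝓝[Ico (0 : ℝ) 1] 1).NeBot := by
        rw [← mem_closure_iff_nhdsWithin_neBot, closure_Ico zero_ne_one]
        exact ⟨zero_le_one, le_rfl⟩
      obtain ⟨t, ht, ht'⟩ := (Filter.Eventually.and
        self_mem_nhdsWithin (hc.eventually (lt_mem_nhds hlt)) : ∀ᶠ t in 𝓝[Ico (0 : ℝ) 1] 1, t ∈ Ico (0 : ℝ) 1 ∧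
          rotationIntegral ρ₀ 0 < rotationIntegral (1 / 2) t).exists
      refine ⟨t, ht, (min_le_left _ _).trans ?_⟩
      obtain ⟨h1, h2⟩ := hr t ht
      have h3 : 1 / 2 < r t := by
        by_contra! h
        rcases h.eq_or_lt with h | h
        · rw [← h, h2] at ht'; exact lt_irrefl _ ht'
        · have := rotationIntegral_strictAnti ht.1 ht.2 (hρ₀.trans_le h1) h
          linarith
      exact div_nonpos_of_nonneg_of_nonpos (by linarith) hneg.le
    · have hq : 2 * L 0 / ρ₀ < 1 := by rwa [div_lt_one hρ₀]
      have hq0 : 0 < 2 * L 0 / ρ₀ := by positivity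
      have hmem : 1 - 2 * L 0 / ρ₀ ∈ Ico (0 : ℝ) 1 := ⟨by linarith, by linarith⟩
      refine ⟨_, hmem, (min_le_right _ _).trans ?_⟩
      set t := 1 - 2 * L 0 / ρ₀ with ht
      obtain ⟨h1, -⟩ := hr t hmem
      have h2 : r t * (1 - t) = 2 * (r t * L 0 / ρ₀) := by rw [ht]; ring
      have h3 : r t * L 0 / ρ₀ ≤ L t := by
        rw [div_le_iff₀ hρ₀, L0, ← mul_div_assoc, div_mul_eq_mul_div, div_le_div_iff_of_pos_right hpos]
        linarith
      linarith
  obtain ⟨t, ht, hHt⟩ := hex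
  obtain ⟨τ₁, hτ₁, hz, hpos⟩ := exists_first_zero Hc H0 ht hHt
  have hsub : Icc 0 τ₁ ⊆ Ico (0 : ℝ) 1 := fun s hs => ⟨hs.1, hs.2.trans_lt hτ₁.2⟩
  have hge : ∀ s ∈ Icc 0 τ₁, 0 ≤ L s ∧ 2 * L s ≤ r s * (1 - s) := fun s hs => by
    have h1 : 0 ≤ H s := by
      rcases hs.2.eq_or_lt with h | h
      · rw [h, hz]
      · exact (hpos s ⟨hs.1, h⟩).le
    have h2 := le_min_iff.1 h1
    exact ⟨h2.1, by linarith [h2.2]⟩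
  have hrpos : ∀ s ∈ Icc 0 τ₁, 0 < r s := fun s hs => hρ₀.trans_le (hr s (hsub hs)).1
  have hgap : ∀ s ∈ Icc 0 τ₁, 0 < r s - 2 * L s := fun s hs => by
    rcases hs.1.eq_or_lt with h | h
    · rw [← h, r0]; linarith
    · have := mul_pos (hrpos s hs) h
      nlinarith [(hge s hs).2]
  refine ⟨r, L, fun τ =>
    rotationIntegral ((r τ - 2 * L τ) / (1 + 2 * L τ)) (τ * r τ / (r τ - 2 * L τ)), τ₁, hτ₁.1,
    ?_, ?_, ?_⟩
  · have rc' := rc.mono hsub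
    have Lc' := Lc.mono hsub
    refine continuousOn_rotationIntegral_comp
      ((rc'.sub (continuousOn_const.mul Lc')).div (continuousOn_const.add
        (continuousOn_const.mul Lc')) fun s hs => by have := (hge s hs).1; positivity)
      ((continuousOn_id.mul rc').div (rc'.sub (continuousOn_const.mul Lc'))
        fun s hs => (hgap s hs).ne') fun s hs => ⟨?_, ?_, ?_⟩
    · have := (hge s hs).1
      exact div_pos (hgap s hs) (by positivity)
    · exact div_nonneg (mul_nonneg hs.1 (hrpos s hs).le) (hgap s hs).le
    · rw [div_le_one (hgap s hs)]
      linarith [(hge s hs).2]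
  · have hm0 : (0 : ℝ) ∈ Icc 0 τ₁ := ⟨le_rfl, hτ₁.1.le⟩
    have hm1 : τ₁ ∈ Icc 0 τ₁ := ⟨hτ₁.1.le, le_rfl⟩
    have hstart : 0 < (ρ₀ - 2 * L 0) / (1 + 2 * L 0) := div_pos (by linarith) (by positivity)
    simp only [r0, zero_mul, zero_div]
    -- If L vanishes at the end, the two pairs of parameters coincide there and Ψ equals the level,
    -- which lies below Ψ(0). Otherwise the second eccentricity reaches 1 and Ψ = 2π lies above
    -- Ψ(0).
    rcases min_choice (L τ₁) (r τ₁ * (1 - τ₁) - 2 * L τ₁) with h | h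
    · have hL1 : L τ₁ = 0 := by rw [← h]; exact hz
      rw [hL1]
      have h2 : τ₁ * r τ₁ / (r τ₁ - 2 * 0) = τ₁ := by
        have := (hrpos τ₁ hm1).ne'
        rw [mul_zero, sub_zero, mul_div_cancel_right₀ _ this]
      rw [h2, show (r τ₁ - 2 * 0) / (1 + 2 * 0) = r τ₁ by ring, (hr τ₁ (hsub hm1)).2]
      refine (rotationIntegral_strictAnti le_rfl one_pos hstart ?_).ne'
      rw [div_lt_iff₀ (by positivity)]
      nlinarith
    · have hL1 : r τ₁ * (1 - τ₁) - 2 * L τ₁ = 0 := by rw [← h]; exact hz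
      have h2 : τ₁ * r τ₁ / (r τ₁ - 2 * L τ₁) = 1 := by
        rw [div_eq_one_iff_eq (hgap τ₁ hm1).ne']; linarith
      rw [h2, rotationIntegral_one, rotationIntegral_zero]
      have h1 : (√(1 + (ρ₀ - 2 * L 0) / (1 + 2 * L 0)))⁻¹ < 1 := inv_lt_one_of_one_lt₀ (by
          rw [Real.lt_sqrt zero_le_one]; linarith)
      have := Real.pi_pos
      nlinarith
  · intro τ hτ
    have h1 := lt_min_iff.1 (hpos τ ⟨hτ.1.le, hτ.2⟩)
    have hmem : τ ∈ Icc 0 τ₁ := ⟨hτ.1.le, hτ.2.le⟩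
    exact ⟨hτ.2.trans hτ₁.2, hrpos τ hmem, h1.1, hLr τ, by linarith [h1.2], (hr τ (hsub hmem)).2,
      rfl⟩

/-! ### Rational rotation angles -/

lemma exists_rat_inv_sq_btwn {A B : ℝ} (hA : 0 < A) (hAB : A < B) :
    ∃ q : ℚ, 0 < (q : ℝ) ∧ A < ((q : ℝ) ^ 2)⁻¹ ∧ ((q : ℝ) ^ 2)⁻¹ < B := by
  have hB := hA.trans hAB
  have hlt : (√B)⁻¹ < (√A)⁻¹ := by
    have := Real.sqrt_pos.2 hA
    gcongr
  obtain ⟨q, h1, h2⟩ := exists_rat_btwn hlt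
  have hsB : 0 < (√B)⁻¹ := inv_pos.2 (Real.sqrt_pos.2 hB)
  have hq : 0 < (q : ℝ) := hsB.trans h1
  refine ⟨q, hq, ?_, ?_⟩
  · rw [lt_inv_comm₀ hA (by positivity)]
    calc (q : ℝ) ^ 2 < ((√A)⁻¹) ^ 2 := by gcongr
      _ = A⁻¹ := by rw [inv_pow, Real.sq_sqrt hA.le]
  · rw [inv_lt_comm₀ (by positivity) hB]
    calc B⁻¹ = ((√B)⁻¹) ^ 2 := by rw [inv_pow, Real.sq_sqrt hB.le]
      _ < (q : ℝ) ^ 2 := by gcongr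

/-- A level on which the first rotation angle is a rational multiple of `π`. -/
lemma exists_rational_level {m : ℝ} (hm : m + 3 ≠ 0) :
    ∃ (q : ℚ) (ρ₀ : ℝ), 0 < ρ₀ ∧ 0 < (2 * ρ₀ - 1) / (m + 3) ∧
      2 * ((2 * ρ₀ - 1) / (m + 3)) < ρ₀ ∧ rotationIntegral ρ₀ 0 = 2 * Real.pi * q := by
  -- The choice ρ₀ = q⁻² - 1 gives R(ρ₀, 0) = 2πq. Taking ρ₀ close to 1/2, on the side fixed by the
  -- sign of m + 3, gives L > 0; the constants give ρ₀ > 1/4 and 2L < 1/8.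
  have key : ∃ q : ℚ, 0 < (q : ℝ) ∧ 5 / 4 < ((q : ℝ) ^ 2)⁻¹ ∧
      0 < (((q : ℝ) ^ 2)⁻¹ - 3 / 2) / (m + 3) ∧ (((q : ℝ) ^ 2)⁻¹ - 3 / 2) / (m + 3) < 1 / 32 := by
    rcases lt_or_gt_of_ne hm with h | h
    · obtain ⟨q, hq, h1, h2⟩ := exists_rat_inv_sq_btwn (A := max (5 / 4) (3 / 2 + (m + 3) / 32))
        (B := 3 / 2) (lt_max_of_lt_left (by norm_num)) (max_lt (by norm_num) (by linarith))
      have h3 := max_lt_iff.1 h1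
      refine ⟨q, hq, h3.1, div_pos_of_neg_of_neg (by linarith) h, ?_⟩
      rw [div_lt_iff_of_neg h]
      linarith [h3.2]
    · obtain ⟨q, hq, h1, h2⟩ := exists_rat_inv_sq_btwn (A := 3 / 2) (B := 3 / 2 + (m + 3) / 32)
        (by norm_num) (by linarith)
      refine ⟨q, hq, by linarith, div_pos (by linarith) h, ?_⟩
      rw [div_lt_iff₀ h]
      linarith
  obtain ⟨q, hq, h1, h2, h3⟩ := key
  have e : (2 * (((q : ℝ) ^ 2)⁻¹ - 1) - 1) / (m + 3) =
      2 * ((((q : ℝ) ^ 2)⁻¹ - 3 / 2) / (m + 3)) := by ring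
  refine ⟨q, ((q : ℝ) ^ 2)⁻¹ - 1, by linarith, by rw [e]; linarith, by rw [e]; linarith, ?_⟩
  rw [rotationIntegral_zero, show 1 + (((q : ℝ) ^ 2)⁻¹ - 1) = ((q : ℝ)⁻¹) ^ 2 by ring,
    Real.sqrt_sq (inv_pos.2 hq).le, inv_inv]

/-- A continuous function with different values at the endpoints takes infinitely many rational
multiples of a fixed positive number. -/
lemma exists_rational_values {Ψ : ℝ → ℝ} {b w : ℝ} (hb : 0 < b) (hw : 0 < w)
    (hc : ContinuousOn Ψ (Icc 0 b)) (hne : Ψ 0 ≠ Ψ b) :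
    ∃ (q : ℕ → ℚ) (t : ℕ → ℝ), Function.Injective q ∧ ∀ n, t n ∈ Ioo 0 b ∧ Ψ (t n) = w * q n := by
  obtain ⟨x, y, hxy, hI⟩ : ∃ x y : ℝ, x < y ∧ Ioo x y ⊆ Ψ '' Ioo 0 b := by
    rcases lt_or_gt_of_ne hne with h | h
    · exact ⟨_, _, h, intermediate_value_Ioo hb.le hc⟩
    · exact ⟨_, _, h, intermediate_value_Ioo' hb.le hc⟩
  obtain ⟨q₁, h1, h2⟩ := exists_rat_btwn (div_lt_div_of_pos_right hxy hw)
  obtain ⟨q₂, h3, h4⟩ := exists_rat_btwn h2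
  have hinf : (Ioo q₁ q₂).Infinite := Ioo_infinite (by exact_mod_cast h3)
  let e := hinf.natEmbedding
  have hv : ∀ n, ∃ t ∈ Ioo 0 b, Ψ t = w * ((e n : ℚ) : ℝ) := fun n => by
    have hmem := (e n).2
    have l1 : (q₁ : ℝ) < ((e n : ℚ) : ℝ) := by exact_mod_cast hmem.1
    have l2 : ((e n : ℚ) : ℝ) < (q₂ : ℝ) := by exact_mod_cast hmem.2
    rw [div_lt_iff₀ hw] at h1
    rw [lt_div_iff₀ hw] at h4
    exact hI ⟨by nlinarith, by nlinarith⟩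
  choose t ht hΨ using hv
  exact ⟨fun n => e n, t, fun i j h => e.injective (Subtype.ext h), fun n => ⟨ht n, hΨ n⟩⟩

end AdS

/-! ### Closed trajectories for every multiplier m ≠ -3 -/

theorem theoremB :
    ∃ M₀ : Set ℝ, IsClosed M₀ ∧ IsDiscrete M₀ ∧
      ∀ m : ℝ, m ∉ M₀ →
        ∃ γ : ℕ → AdS.Curve,
          (∀ n, AdS.IsTrajectory m (γ n) ∧ AdS.IsPeriodic (γ n)) ∧
          ∀ i j, i ≠ j → ¬ AdS.Equivalent (γ i) (γ j) := by
  open AdS in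
  -- At m = -3 the relation 2ρ - 1 = L(m + 3) no longer recovers L from ρ.
  refine ⟨{-3}, isClosed_singleton, Set.Subsingleton.isDiscrete Set.subsingleton_singleton,
    fun m hm => ?_⟩
  have hm3 : m + 3 ≠ 0 := fun h => hm (by rw [Set.mem_singleton_iff]; linarith)
  obtain ⟨q, ρ₀, hρ₀, hL₀, hρL, hq⟩ := exists_rational_level hm3
  obtain ⟨r, L, Ψ, τ₁, hτ₁, hΨc, hΨne, hpath⟩ := exists_path hm3 hρ₀ hL₀ hρL
  obtain ⟨q', t, hinj, ht⟩ := exists_rational_values hτ₁ Real.two_pi_pos hΨc hΨne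
  have hcurve : ∀ n, ∃ (c δ : ℝ) (γ Γp Γm : Curve) (k : ℝ → ℝ), 0 < δ ∧
      IsSpinorFrame γ Γp Γm k (fun _ => 1) ∧ Set.range k = Set.Icc (c - δ) (c + δ) ∧
      IsTrajectory m γ ∧ IsPeriodic γ ∧ rotation m c δ (m - 2) = Real.pi * q' n := by
    intro n
    obtain ⟨hmem, hval⟩ := ht n
    obtain ⟨hlt, hr, hL, hrL, hgap, hplus, hΨ⟩ := hpath (t n) hmem
    have ht0 : 0 < t n := hmem.1
    generalize t n = τ at *
    generalize r τ = ρ at *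
    generalize L τ = l at *
    have hm' : m = (2 * ρ - 1) / l - 3 := by field_simp; linarith
    have hδ : 0 < 2 * τ * ρ / l := by positivity
    have hgap' : 0 < ρ - 2 * l := by nlinarith [mul_pos ht0 hr]
    have h1 : -1 - 1 / l + 2 * τ * ρ / l < m - 2 := by
      have : m - 2 - (-1 - 1 / l + 2 * τ * ρ / l) = 2 * (ρ * (1 - τ) - 2 * l) / l := by
        rw [hm']; field_simp; ring
      have h2 : 0 < 2 * (ρ * (1 - τ) - 2 * l) / l := div_pos (by linarith) hL
      linarith
    have h2 : -1 - 1 / l < -1 := by have : 0 < 1 / l := by positivity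
                                    linarith
    obtain ⟨γ, Γp, Γm, k, hf, hrange, htraj, hper⟩ := exists_trajectory hδ h1 h2
    have rp : rotation m (-1 - 1 / l) (2 * τ * ρ / l) (m + 2) = Real.pi * q := by
      rw [rotation_eq hδ (by linarith) (by linarith)]
      have e1 : m + 2 - (-1 - 1 / l) = 2 * ρ / l := by rw [hm']; field_simp; ring
      have e2 : m - 2 * (-1 - 1 / l) - (m + 2) = 2 / l := by field_simp; ring
      rw [e1, e2, show 2 * ρ / l / (2 / l) = ρ by field_simp,
        show 2 * τ * ρ / l / (2 * ρ / l) = τ by field_simp, hplus, hq]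
      ring
    have rm : rotation m (-1 - 1 / l) (2 * τ * ρ / l) (m - 2) = Real.pi * q' n := by
      rw [rotation_eq hδ (by linarith) (by linarith)]
      have e1 : m - 2 - (-1 - 1 / l) = 2 * (ρ - 2 * l) / l := by rw [hm']; field_simp; ring
      have e2 : m - 2 * (-1 - 1 / l) - (m - 2) = 2 * (1 + 2 * l) / l := by field_simp; ring
      have e3 : 1 + 2 * l ≠ 0 := by positivity
      rw [e1, e2, show 2 * (ρ - 2 * l) / l / (2 * (1 + 2 * l) / l) = (ρ - 2 * l) / (1 + 2 * l) by
        field_simp, show 2 * τ * ρ / l / (2 * (ρ - 2 * l) / l) = τ * ρ / (ρ - 2 * l) by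
          field_simp, ← hΨ, hval]
      ring
    -- The angles are πq and πq', half of R, so the common denominator is doubled to reach multiples
    -- of 2π.
    refine ⟨_, _, γ, Γp, Γm, k, hδ, hf, hrange, htraj, hper (2 * q.den * (q' n).den)
      (q.num * (q' n).den) ((q' n).num * q.den) (by have := q.den_pos; have := (q' n).den_pos
                                                    positivity) ?_ ?_, rm⟩
    · rw [rp]
      have : (q : ℝ) * q.den = q.num := by exact_mod_cast Rat.mul_den_eq_num q
      push_cast
      linear_combination 2 * (q' n).den * Real.pi * this
    · rw [rm]
      have : (q' n : ℝ) * (q' n).den = (q' n).num := by exact_mod_cast Rat.mul_den_eq_num (q' n)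
      push_cast
      linear_combination 2 * q.den * Real.pi * this
  choose c δ γ Γp Γm k hδ hf hrange htraj hper hrot using hcurve
  refine ⟨γ, fun n => ⟨htraj n, hper n⟩, fun i j hij he => hij (hinj ?_)⟩
  -- Equivalent curves share the range [c - δ, c + δ] of the curvature, hence c, δ and the second
  -- rotation angle, which determines q'.
  have h1 := Equivalent.range_curvature (hf i) (hf j) he
  rw [hrange, hrange, Set.Icc_eq_Icc_iff (by linarith [hδ i])] at h1
  have hc : c i = c j := by linarith [h1.1, h1.2]
  have hd : δ i = δ j := by linarith [h1.1, h1.2]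
  have h2 := hrot i
  rw [hc, hd, hrot j] at h2
  have h3 : (q' j : ℝ) = q' i := mul_left_cancel₀ Real.pi_pos.ne' h2
  exact_mod_cast h3.symm
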